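/- Let $\mathbb N=\{1,2,\dots\}$, let $\log$ be the natural logarithm and let $H(X)=\mathbf E[-\log P(X)]\in[0,\infty]$ be the Shannon entropy of a discrete random variable $X$. Given periods $\pi_r\in\mathbb N$ and seeds $\sigma_r\in\{1,\dots,\pi_r\}$ $(r\in\mathbb N)$, the multiperiodic sequence $(k_t)_{t\in\mathbb N}$, $k_t\in\mathbb N\cup\{\infty\}$, is defined as follows: if $(k^{(r)}_t)_t$ is the subsequence obtained from $(k_t)_t$ by deleting all tokens $k_t<r$, then for every $r$ and every position $t$ of this subsequence, $k^{(r)}_t=r\iff t\equiv\sigma_r \pmod{\pi_r}$; where this leaves $k_t$ different from every natural number, $k_t=\infty$. A multiperiodic process $(K_t)_{t\in\mathbb N}$ with periods $(\pi_r)$ is the random multiperiodic sequence whose seeds $\Sigma_r$ are independent and uniformly distributed on $\{1,\dots,\pi_r\}$. Write $X_1^T=(X_1,\dots,X_T)$ and let $\mathcal N_T=\{r\in\mathbb N: K_t=r\text{ for some }1\le t\le T\}$ be the random set of types in $K_1^T$. For sequences $f,g$ write $f(T)\sim g(T)$ if $\lim_{T\to\infty}\log f(T)/\log g(T)=1$.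 **Theorem.** Let $(K_t)_{t\in\mathbb N}$ be a multiperiodic process with periods $(\pi_r)_{r\in\mathbb N}$. 1. For all real $q>0$ and all $T,t\in\mathbb N$, $$H(K_1^T)\le\bigl(e\,\mathbf E\,\mathrm{card}\,\mathcal N_T+2\bigr)\bigl((q+2)\log T+q\log\mathbf E K_t^{1/q}\bigr),$$ where the right-hand side is $+\infty$ if $\mathbf E K_t^{1/q}=\infty$. 2. Let $(Z_k)_{k\in\mathbb N}$ be a sequence of independent fair coin flips, independent of $(K_t)_{t\in\mathbb N}$, and let $X_t=(K_t,Z_{K_t})$ be the Santa Fe process (with $Z_\infty$ read as a fixed symbol). Then for all real $q>0$ and all $T,t\in\mathbb N$, $$\mathbf E\,\mathrm{card}\,\mathcal N_T\cdot\log 2\le H(X_1^T)\le\bigl(e\,\mathbf E\,\mathrm{card}\,\mathcal N_T+2\bigr)\Bigl((q+2)\log T+q\log\mathbf E K_t^{1/q}+\frac{\log 2}{e}\Bigr).$$ 3. If moreover $\pi_r=1+\lceil cr\rceil$ for all $r\in\mathbb N$ with some real $c>0$, then with $\beta=c/(c+1)$ we have $\mathbf E\,\mathrm{card}\,\mathcal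 N_T\sim T^{\beta}$, all $H(X_1^T)$ are finite, and Hilberg's law holds with zero entropy rate: $$\lim_{T\to\infty}\frac{H(X_1^T)}{T}=0\qquad\text{and}\qquad \frac{H(X_1^T)}{T}\sim\frac1{T^{1-\beta}}.$$ -/

import Mathlib

open Real Set Filter Topology MeasureTheory ProbabilityTheory
open scoped ENNReal

/-- The position of the `t`-th token of `k` in the decimated subsequence `k⁽ʳ⁾`, which arises
from `k` by deleting all tokens smaller than `r` (meaningful when `r ≤ k t`). -/
def decimatedPos (k : ℕ+ → ℕ∞) (r t : ℕ+) : ℕ :=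
  ((Finset.Icc 1 t).filter fun s => ((r : ℕ) : ℕ∞) ≤ k s).card

/-- `k` is the multiperiodic sequence with periods `per` and seeds `seed`: for each `r`, in the
subsequence of the tokens that are at least `r`, exactly the tokens at positions congruent to
`seed r` modulo `per r` are equal to `r`. A token that is equal to no natural number is `∞`. -/
structure IsMultiperiodicSeq (per : ℕ+ → ℕ+) (seed : ℕ+ → ℕ) (k : ℕ+ → ℕ∞) : Prop where
  one_le : ∀ t, 1 ≤ k t
  eq_iff : ∀ r t : ℕ+, ((r : ℕ) : ℕ∞) ≤ k t →
    (k t = ((r : ℕ) : ℕ∞) ↔ decimatedPos k r t ≡ seed r [MOD (per r : ℕ)])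

/-- For all periods and seeds there is a multiperiodic sequence. -/
theorem IsMultiperiodicSeq.exists (per : ℕ+ → ℕ+) (seed : ℕ+ → ℕ) :
    ∃ k, IsMultiperiodicSeq per seed k := by
  classical
  let pos : Set ℕ+ → ℕ+ → ℕ := fun A t => ((Finset.Icc 1 t).filter fun s => s ∈ A).card
  let S : ℕ → Set ℕ+ := fun n => Nat.rec Set.univ
    (fun n A => {t | t ∈ A ∧ ¬ pos A t ≡ seed n.succPNat [MOD (per n.succPNat : ℕ)]}) n
  have hS : ∀ n t, t ∈ S (n + 1) ↔
      t ∈ S n ∧ ¬ pos (S n) t ≡ seed n.succPNat [MOD (per n.succPNat : ℕ)] :=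
    fun n t => Iff.rfl
  have hanti : Antitone S := antitone_nat_of_succ_le fun n t ht => ((hS n t).1 ht).1
  let k : ℕ+ → ℕ∞ := fun t => ⨅ (n : ℕ) (_ : t ∉ S n), (n : ℕ∞)
  have hk : ∀ (n : ℕ) t, ((n + 1 : ℕ) : ℕ∞) ≤ k t ↔ t ∈ S n := by
    intro n t
    simp only [k, le_iInf_iff]
    constructor
    · intro h
      by_contra hn
      have := h n hn
      rw [Nat.cast_le] at this
      omega
    · intro h m hm
      rw [Nat.cast_le]
      by_contra hlt
      exact hm (hanti (by omega : m ≤ n) h)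
  refine ⟨k, fun t => by simpa using (hk 0 t).2 trivial, fun r t hrt => ?_⟩
  obtain ⟨n, rfl⟩ : ∃ n : ℕ, n.succPNat = r := ⟨r.natPred, PNat.succPNat_natPred r⟩
  have hpos : decimatedPos k n.succPNat t = pos (S n) t := by
    unfold decimatedPos
    exact congrArg Finset.card (Finset.ext fun s => by
      rw [Finset.mem_filter, Finset.mem_filter]
      exact and_congr_right fun _ => hk n s)
  simp only [Nat.succPNat_coe, Nat.succ_eq_add_one] at hrt ⊢
  rw [hpos]
  have hmem := (hk n t).1 hrt
  have h2 := hk (n + 1) t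
  have h3 : k t = ((n + 1 : ℕ) : ℕ∞) ↔ ¬ ((n + 1 + 1 : ℕ) : ℕ∞) ≤ k t := by
    rw [not_le, Nat.cast_add (n + 1) 1, Nat.cast_one]
    constructor
    · intro h
      rw [h]
      exact_mod_cast Nat.lt_succ_self (n + 1)
    · intro h
      exact le_antisymm (ENat.lt_natCast_add_one_iff.1 h) hrt
  rw [h3, h2, hS]
  tauto

section Processes

variable {Ω : Type*} [MeasurableSpace Ω]

/-- `K` is a multiperiodic process with periods `per`: a random multiperiodic sequence whose seeds
are independent random variables, the `r`-th one being uniform on `{1, …, per r}`. -/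
structure IsMultiperiodicProcess (μ : Measure Ω) (per : ℕ+ → ℕ+) (K : ℕ+ → Ω → ℕ∞) : Prop where
  measurable : ∀ t, Measurable (K t)
  exists_seeds : ∃ seed : ℕ+ → Ω → ℕ,
    (∀ r, Measurable (seed r)) ∧
    iIndepFun seed μ ∧
    (∀ r, ∀ i ∈ Finset.Icc 1 (per r : ℕ), μ {ω | seed r ω = i} = ((per r : ℕ) : ℝ≥0∞)⁻¹) ∧
    ∀ᵐ ω ∂μ, IsMultiperiodicSeq per (fun r => seed r ω) (fun t => K t ω)

/-- `Z` is a sequence of independent fair coin flips. -/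
structure IsFairCoinFlips (μ : Measure Ω) (Z : ℕ+ → Ω → Bool) : Prop where
  measurable : ∀ r, Measurable (Z r)
  indep : iIndepFun Z μ
  fair : ∀ r b, μ {ω | Z r ω = b} = 2⁻¹

/-- The Santa Fe process `X_t = (K_t, Z_{K_t})`; where `K_t = ∞` there is no bit to be copied. -/
def santaFe (K : ℕ+ → Ω → ℕ∞) (Z : ℕ+ → Ω → Bool) (t : ℕ+) (ω : Ω) : ℕ∞ × Option Bool :=
  (K t ω, if K t ω = ⊤ then none else some (Z (K t ω).toNat.toPNat' ω))

/-- The block `X_1^T = (X_1, …, X_T)`. -/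
def block {α : Type*} (X : ℕ+ → Ω → α) (T : ℕ) (ω : Ω) : Fin T → α :=
  fun i => X (i : ℕ).succPNat ω

/-- The Shannon entropy (in nats, possibly infinite) of a discrete random variable. -/
noncomputable def shannonEntropy {α : Type*} (μ : Measure Ω) (X : Ω → α) : ℝ≥0∞ :=
  ∑' x, ENNReal.ofReal (negMulLog (μ.real {ω | X ω = x}))

/-- The random set of types (natural numbers) in the sample `K_1^T`. -/
def typeSet (K : ℕ+ → Ω → ℕ∞) (T : ℕ) (ω : Ω) : Set ℕ+ :=
  {r | ∃ t : ℕ+, (t : ℕ) ≤ T ∧ K t ω = ((r : ℕ) : ℕ∞)}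

/-- The expected number of types in the sample `K_1^T` (an integral of a function with values
in `{0, …, T}`). -/
noncomputable def expectedTypes (μ : Measure Ω) (K : ℕ+ → Ω → ℕ∞) (T : ℕ) : ℝ :=
  ∫ ω, ((typeSet K T ω).ncard : ℝ) ∂μ

/-- The expectation `E Y^a` of a power of an extended natural random variable. -/
noncomputable def expectedPow (μ : Measure Ω) (Y : Ω → ℕ∞) (a : ℝ) : ℝ≥0∞ :=
  ∫⁻ ω, (Y ω : ℝ≥0∞) ^ a ∂μ

end Processes

/-- Equality of the asymptotic power-law growth: `log f(T) / log g(T) → 1`. -/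
def SamePowerLaw (f g : ℕ → ℝ) : Prop :=
  Tendsto (fun T => log (f T) / log (g T)) atTop (𝓝 1)

/-! A multiperiodic block is rigid. Once the tokens below `r` are placed, a single occurrence of `r`
reveals its seed modulo the period and hence all its occurrences. So a block of finite tokens is
determined by the set of pairs (type, time of first occurrence), see `injOn_firstOccurrences`.

Entropy bound: give each pair `(r, t)` the weight `1 / (T r (r + 1))`. The weights have sum at most
`1`, so the products over finite sets of pairs have sum at most `∏ (1 + a_i) ≤ e`. Gibbs' inequality
then gives `H ≤ 1 + E ∑ log (T r (r + 1))`, summed over the types in the block. The logarithm of `r`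
is bounded by a tangent line in `r ^ (1 / q)`; its sum is extended to all `T` positions, whose
expectation is `T E K ^ (1 / q)` because the tokens are identically distributed. The stated
constants absorb the rest, except at `T = 1`, where `log T = 0` and a separate code is needed.

Santa Fe: given the block of `K`, the bits shown are one fair coin per type, so `H(X) = H(K) + E
card N_T · log 2` exactly (`shannonEntropy_santaFe`). Both bounds of the second part follow.

Linear periods: the position of a token in the `r`-th decimated sequence depends only on smaller
seeds, hence is independent of the seed of `r`. Thus `P(K_t = r) = P(K_t ≥ r) / π_r`, and `P(K_t >
n) = ∏ (1 - 1 / π_i)` lies between multiples of `n ^ (-1 / c)`. Counting small types trivially and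
large ones by tokens gives `E card N_T ≤ R + T P(K > R)`, optimal at `R = T ^ β`. Conversely every
type up to a multiple of `T ^ β` must occur, as its decimated sequence is still longer than its
period. The moment with `q = 2 c` is finite, so the entropy is `T ^ β` up to constants and a
logarithm. -/

/-! ### Rigidity of multiperiodic sequences -/

theorem decimatedPos_congr {k k' : ℕ+ → ℕ∞} {r t : ℕ+}
    (h : ∀ s ≤ t, ((r : ℕ) : ℕ∞) ≤ k s ↔ ((r : ℕ) : ℕ∞) ≤ k' s) :
    decimatedPos k r t = decimatedPos k' r t :=
  congrArg Finset.card <| Finset.filter_congr fun s hs => h s (Finset.mem_Icc.1 hs).2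

theorem ENat.add_one_le_iff_le_and_ne {n : ℕ} {x : ℕ∞} :
    ((n + 1 : ℕ) : ℕ∞) ≤ x ↔ (n : ℕ∞) ≤ x ∧ x ≠ n := by
  rw [Nat.cast_add, Nat.cast_one, ENat.add_one_le_iff (ENat.natCast_ne_top n), lt_iff_le_and_ne, ne_comm]

/-- Up to time `T`, the tokens that are at most `n` are determined by the residues of the seeds
of those types up to `n` that occur. -/
theorem IsMultiperiodicSeq.le_iff_le {per : ℕ+ → ℕ+} {s s' : ℕ+ → ℕ} {k k' : ℕ+ → ℕ∞}
    (h : IsMultiperiodicSeq per s k) (h' : IsMultiperiodicSeq per s' k') (T : ℕ+) (n : ℕ)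
    (hs : ∀ r : ℕ+, (r : ℕ) ≤ n → s r ≡ s' r [MOD (per r : ℕ)] ∨
      ∀ t ≤ T, k t ≠ ((r : ℕ) : ℕ∞) ∧ k' t ≠ ((r : ℕ) : ℕ∞)) :
    ∀ t ≤ T, ((n + 1 : ℕ) : ℕ∞) ≤ k t ↔ ((n + 1 : ℕ) : ℕ∞) ≤ k' t := by
  induction n with
  | zero => intro t _; simp [h.one_le t, h'.one_le t]
  | succ n ih =>
    intro t ht
    have ih := ih fun r hr => hs r (by omega)
    obtain ⟨r, hr⟩ : ∃ r : ℕ+, (r : ℕ) = n + 1 := ⟨n.succPNat, rfl⟩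
    rw [ENat.add_one_le_iff_le_and_ne, ENat.add_one_le_iff_le_and_ne (x := k' t), ih t ht]
    refine and_congr_right fun hle => not_congr ?_
    have hle' := (ih t ht).2 hle
    rw [← hr] at hle hle' ⊢
    -- By induction the tokens that are at least `r` sit at the same times, so decimated positions
    -- agree and only the seed of `r` matters.
    rcases hs r hr.le with hm | hne
    · rw [h.eq_iff r t hle', h'.eq_iff r t hle,
        decimatedPos_congr (k' := k') fun u hu => by rw [hr]; exact ih u (hu.trans ht)]
      exact ⟨fun e => e.trans hm, fun e => e.trans hm.symm⟩
    · simp [hne t ht]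

theorem ENat.eq_of_forall_add_one_le_iff {x y : ℕ∞} (hx : x ≠ ⊤)
    (h1 : 1 ≤ x) (h : ∀ n : ℕ, ((n + 1 : ℕ) : ℕ∞) ≤ x ↔ ((n + 1 : ℕ) : ℕ∞) ≤ y) : x = y := by
  lift x to ℕ using hx
  obtain ⟨m, rfl⟩ : ∃ m, x = m + 1 := ⟨x - 1, by have : 1 ≤ x := by exact_mod_cast h1
                                                 omega⟩
  have h2 := (h m).1 le_rfl
  have h3 := (h (m + 1)).not.1 (by rw [Nat.cast_le]; omega)
  refine le_antisymm h2 ?_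
  rw [not_le, Nat.cast_add (m + 1), Nat.cast_one] at h3
  exact ENat.lt_natCast_add_one_iff.1 h3

/-- A block of finite tokens of a multiperiodic sequence is determined by one occurrence of each
of its types. -/
theorem IsMultiperiodicSeq.eq_of_occurrences {per : ℕ+ → ℕ+} {s s' : ℕ+ → ℕ} {k k' : ℕ+ → ℕ∞}
    (h : IsMultiperiodicSeq per s k) (h' : IsMultiperiodicSeq per s' k') (T : ℕ+)
    (hfin : ∀ t ≤ T, k t ≠ ⊤)
    (hocc : ∀ r : ℕ+, ∀ t ≤ T, (k t = ((r : ℕ) : ℕ∞) ∨ k' t = ((r : ℕ) : ℕ∞)) →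
      ∃ u ≤ T, k u = ((r : ℕ) : ℕ∞) ∧ k' u = ((r : ℕ) : ℕ∞)) :
    ∀ t ≤ T, k t = k' t := by
  have key : ∀ n : ℕ, ∀ t ≤ T, ((n + 1 : ℕ) : ℕ∞) ≤ k t ↔ ((n + 1 : ℕ) : ℕ∞) ≤ k' t := by
    intro n
    induction n using Nat.strong_induction_on with
    | _ n ih =>
      refine h.le_iff_le h' T n fun r hr => ?_
      by_cases hex : ∃ u ≤ T, k u = ((r : ℕ) : ℕ∞) ∧ k' u = ((r : ℕ) : ℕ∞)
      · obtain ⟨u, hu, hku, hku'⟩ := hex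
        obtain ⟨m, hm⟩ : ∃ m, (r : ℕ) = m + 1 := ⟨r.natPred, (PNat.natPred_add_one r).symm⟩
        -- A common occurrence has the same decimated position in both sequences, so both seeds are
        -- congruent to it.
        have e := (h.eq_iff r u hku.ge).1 hku
        rw [decimatedPos_congr (k' := k') fun v hv => by rw [hm]; exact ih m (by omega) v (hv.trans hu)] at e
        exact Or.inl (e.symm.trans ((h'.eq_iff r u hku'.ge).1 hku'))
      · exact Or.inr fun t ht =>
          ⟨fun e => hex (hocc r t ht (Or.inl e)), fun e => hex (hocc r t ht (Or.inr e))⟩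
  exact fun t ht => ENat.eq_of_forall_add_one_le_iff (hfin t ht) (h.one_le t) fun n => key n t ht

/-! ### Counting in decimated sequences -/

theorem decimatedPos_lt {k : ℕ+ → ℕ∞} {r t u : ℕ+} (htu : t < u) (hu : ((r : ℕ) : ℕ∞) ≤ k u) :
    decimatedPos k r t < decimatedPos k r u := by
  refine Finset.card_lt_card ((Finset.ssubset_iff_of_subset ?_).2 ⟨u, ?_, ?_⟩)
  · exact Finset.filter_subset_filter _ (Finset.Icc_subset_Icc_right htu.le)
  · simp [hu]
  · simp [htu]

theorem decimatedPos_mono (k : ℕ+ → ℕ∞) (r : ℕ+) : Monotone (decimatedPos k r) :=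
  fun _ _ htu => Finset.card_le_card <|
    Finset.filter_subset_filter _ (Finset.Icc_subset_Icc_right htu)

/-- Positions increase strictly along surviving tokens. This turns occurrences of `r` into members
of a residue class in an interval. -/
theorem image_decimatedPos (k : ℕ+ → ℕ∞) (r T : ℕ+) :
    ((Finset.Icc 1 T).filter fun t => ((r : ℕ) : ℕ∞) ≤ k t).image (decimatedPos k r) =
      Finset.Ioc 0 (decimatedPos k r T) := by
  refine Finset.eq_of_subset_of_card_le ?_ ?_
  · intro j hj
    obtain ⟨t, ht, rfl⟩ := Finset.mem_image.1 hj
    rw [Finset.mem_filter, Finset.mem_Icc] at ht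
    exact Finset.mem_Ioc.2 ⟨Finset.card_pos.2 ⟨t, by simp [ht.2]⟩, decimatedPos_mono k r ht.1.2⟩
  · rw [Finset.card_image_of_injOn, Nat.card_Ioc]
    · rfl
    · intro t ht u hu e
      simp only [Finset.coe_filter, Set.mem_ofPred_eq] at ht hu
      rcases lt_trichotomy t u with h | h | h
      · exact absurd e (decimatedPos_lt h hu.2).ne
      · exact h
      · exact absurd e (decimatedPos_lt h ht.2).ne'

theorem IsMultiperiodicSeq.card_eq {per : ℕ+ → ℕ+} {s : ℕ+ → ℕ} {k : ℕ+ → ℕ∞}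
    (h : IsMultiperiodicSeq per s k) (r T : ℕ+) :
    ((Finset.Icc 1 T).filter fun t => k t = ((r : ℕ) : ℕ∞)).card =
      ((Finset.Ioc 0 (decimatedPos k r T)).filter fun j => j ≡ s r [MOD (per r : ℕ)]).card := by
  rw [← image_decimatedPos, Finset.filter_image, Finset.card_image_of_injOn, Finset.filter_filter]
  · congr 1
    refine Finset.filter_congr fun t _ => ⟨fun e => ⟨e.ge, (h.eq_iff r t e.ge).1 e⟩,
      fun e => (h.eq_iff r t e.1).2 e.2⟩
  · intro t ht u hu e
    simp only [Finset.coe_filter, Set.mem_ofPred_eq, Finset.mem_filter] at ht hu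
    rcases lt_trichotomy t u with h | h | h
    · exact absurd e (decimatedPos_lt h hu.1.2).ne
    · exact h
    · exact absurd e (decimatedPos_lt h ht.1.2).ne'

/-- The count is a difference of two floors, and two fractional parts differ by less than one. -/
theorem Nat.abs_card_Ioc_filter_modEq_sub_lt (M p v : ℕ) (hp : 0 < p) :
    |(((Finset.Ioc 0 M).filter fun j => j ≡ v [MOD p]).card : ℝ) - M / p| < 1 := by
  have h := Nat.Ioc_filter_modEq_card 0 M hp v
  have hp' : (0 : ℚ) < p := by exact_mod_cast hp
  have hmono : ⌊(((0 : ℕ) : ℚ) - v) / p⌋ ≤ ⌊((M : ℚ) - v) / p⌋ := by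
    refine Int.floor_mono ?_
    gcongr
    simp
  rw [max_eq_left (sub_nonneg.2 hmono)] at h
  have h1 := Int.floor_le ((((0 : ℕ) : ℚ) - v) / p)
  have h2 := Int.lt_floor_add_one ((((0 : ℕ) : ℚ) - v) / p)
  have h3 := Int.floor_le (((M : ℚ) - v) / p)
  have h4 := Int.lt_floor_add_one (((M : ℚ) - v) / p)
  have h5 : ((M : ℚ) - v) / p - (((0 : ℕ) : ℚ) - v) / p = M / p := by
    rw [← sub_div]; simp
  have h6 : ((((Finset.Ioc 0 M).filter fun j => j ≡ v [MOD p]).card : ℤ) : ℚ) =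
      ⌊((M : ℚ) - v) / p⌋ - ⌊(((0 : ℕ) : ℚ) - v) / p⌋ := by rw [h]; push_cast; ring
  rw [Int.cast_natCast] at h6
  have h7 : |(((Finset.Ioc 0 M).filter fun j => j ≡ v [MOD p]).card : ℚ) - M / p| < 1 := by
    rw [h6, abs_lt]
    constructor <;> linarith
  have h8 := (Rat.cast_lt (K := ℝ)).2 h7
  push_cast at h8
  exact h8

theorem decimatedPos_add_one (k : ℕ+ → ℕ∞) (r T : ℕ+) :
    decimatedPos k (r + 1) T + ((Finset.Icc 1 T).filter fun t => k t = ((r : ℕ) : ℕ∞)).card =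
      decimatedPos k r T := by
  unfold decimatedPos
  rw [← Finset.card_union_of_disjoint]
  · congr 1
    ext t
    simp only [Finset.mem_union, Finset.mem_filter, PNat.add_coe, PNat.one_coe,
      ENat.add_one_le_iff_le_and_ne]
    constructor
    · rintro (⟨h1, h2, -⟩ | ⟨h1, h2⟩)
      · exact ⟨h1, h2⟩
      · exact ⟨h1, h2.ge⟩
    · rintro ⟨h1, h2⟩
      by_cases h : k t = ((r : ℕ) : ℕ∞)
      · exact Or.inr ⟨h1, h⟩
      · exact Or.inl ⟨h1, h2, h⟩
  · rw [Finset.disjoint_filter]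
    intro t _ h1 h2
    rw [PNat.add_coe, PNat.one_coe, ENat.add_one_le_iff_le_and_ne] at h1
    exact h1.2 h2

theorem IsMultiperiodicSeq.decimatedPos_one {per : ℕ+ → ℕ+} {s : ℕ+ → ℕ} {k : ℕ+ → ℕ∞}
    (h : IsMultiperiodicSeq per s k) (T : ℕ+) : decimatedPos k 1 T = T := by
  unfold decimatedPos
  rw [Finset.filter_true_of_mem fun t _ => by simpa using h.one_le t]
  simp

/-- Whatever the seeds, deleting `r` removes the fraction `1 / per r` of the tokens with an error
below one. -/
theorem IsMultiperiodicSeq.decimatedPos_add_one_ge {per : ℕ+ → ℕ+} {s : ℕ+ → ℕ} {k : ℕ+ → ℕ∞}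
    (h : IsMultiperiodicSeq per s k) (r T : ℕ+) :
    (decimatedPos k r T : ℝ) * (1 - ((per r : ℕ) : ℝ)⁻¹) - 1 ≤ decimatedPos k (r + 1) T := by
  have h1 := (abs_lt.1 (Nat.abs_card_Ioc_filter_modEq_sub_lt (decimatedPos k r T) (per r) (s r)
    (per r).pos)).2
  have h2 : (decimatedPos k (r + 1) T : ℝ) +
      ((Finset.Icc 1 T).filter fun t => k t = ((r : ℕ) : ℕ∞)).card = decimatedPos k r T := by
    exact_mod_cast decimatedPos_add_one k r T
  rw [h.card_eq] at h2
  rw [mul_sub, mul_one, ← div_eq_mul_inv]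
  linarith

theorem IsMultiperiodicSeq.exists_eq {per : ℕ+ → ℕ+} {s : ℕ+ → ℕ} {k : ℕ+ → ℕ∞}
    (h : IsMultiperiodicSeq per s k) (r T : ℕ+) (hr : (per r : ℕ) ≤ decimatedPos k r T) :
    ∃ t ≤ T, k t = ((r : ℕ) : ℕ∞) := by
  have h1 := (abs_lt.1 (Nat.abs_card_Ioc_filter_modEq_sub_lt (decimatedPos k r T) (per r) (s r)
    (per r).pos)).1
  have h2 : (1 : ℝ) ≤ (decimatedPos k r T : ℝ) / (per r : ℕ) := by
    rw [one_le_div (by exact_mod_cast (per r).pos)]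
    exact_mod_cast hr
  rw [← h.card_eq] at h1
  have h3 : 0 < ((Finset.Icc 1 T).filter fun t => k t = ((r : ℕ) : ℕ∞)).card := by
    have : (0 : ℝ) < ((Finset.Icc 1 T).filter fun t => k t = ((r : ℕ) : ℕ∞)).card := by linarith
    exact_mod_cast this
  obtain ⟨t, ht⟩ := Finset.card_pos.1 h3
  rw [Finset.mem_filter, Finset.mem_Icc] at ht
  exact ⟨t, ht.1.2, ht.2⟩

theorem decimatedPos_pos {k : ℕ+ → ℕ∞} {r t : ℕ+} (h : ((r : ℕ) : ℕ∞) ≤ k t) :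
    0 < decimatedPos k r t :=
  Finset.card_pos.2 ⟨t, by simp [h]⟩

theorem decimatedPos_le (k : ℕ+ → ℕ∞) (r t : ℕ+) : decimatedPos k r t ≤ t :=
  (Finset.card_filter_le _ _).trans (by simp)

/-! ### Law of a single token -/

/-- The probability that a token of a multiperiodic process exceeds `n`. -/
noncomputable def tailProb (per : ℕ+ → ℕ+) (n : ℕ) : ℝ :=
  ∏ i ∈ Finset.range n, (1 - ((per i.succPNat : ℕ) : ℝ)⁻¹)

section

variable {Ω : Type*} [MeasurableSpace Ω] {μ : Measure Ω}

theorem measure_modEq_of_uniform [IsProbabilityMeasure μ] {p : ℕ} (hp : 0 < p) {s : Ω → ℕ}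
    (hs : Measurable s) (hunif : ∀ i ∈ Finset.Icc 1 p, μ {ω | s ω = i} = (p : ℝ≥0∞)⁻¹) (m : ℕ) :
    μ {ω | m ≡ s ω [MOD p]} = (p : ℝ≥0∞)⁻¹ := by
  obtain ⟨j, hj, hmj⟩ : ∃ j ∈ Finset.Icc 1 p, m ≡ j [MOD p] := by
    by_cases h0 : m % p = 0
    · exact ⟨p, by simp; omega, by simp [Nat.ModEq, h0]⟩
    · have := Nat.mod_lt m hp
      exact ⟨m % p, by simp; omega, (Nat.mod_modEq m p).symm⟩
  rw [← hunif j hj]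
  -- The `p` prescribed masses already add up to one, so other values are null.
  have hmem : ∀ᵐ ω ∂μ, s ω ∈ Finset.Icc 1 p := by
    change s ⁻¹' ((Finset.Icc 1 p : Finset ℕ) : Set ℕ) ∈ ae μ
    rw [mem_ae_iff_prob_eq_one (hs MeasurableSet.of_discrete),
      ← sum_measure_preimage_singleton _ fun i _ => hs (measurableSet_singleton i),
      Finset.sum_congr rfl (f := fun b => μ (s ⁻¹' {b})) fun i hi => hunif i hi, Finset.sum_const, Nat.card_Icc, nsmul_eq_mul, Nat.add_sub_cancel]
    exact ENNReal.mul_inv_cancel (by exact_mod_cast hp.ne') (ENNReal.natCast_ne_top p)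
  refine measure_congr ?_
  filter_upwards [hmem] with ω hω
  rw [Finset.mem_Icc] at hω hj
  refine propext ⟨fun h => ?_, fun h => ?_⟩
  · refine Nat.ModEq.eq_of_abs_lt ((h.symm.trans hmj)) ?_
    rw [abs_lt]; omega
  · change s ω = j at h
    change m ≡ s ω [MOD p]
    rw [h]; exact hmj

/-- The position of the `t`-th token in the decimated subsequence, `0` if the token is deleted, as
a function of the seeds of smaller types. -/
noncomputable def seedPos (per : ℕ+ → ℕ+) (r t : ℕ+) (v : Finset.Iio r → ℕ) : ℕ :=
  -- The filler seed `0` for types from `r` on is irrelevant: by `le_iff_le` the smaller seeds fix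
  -- which tokens are at least `r`. The value `0` can mark deletion since true positions are
  -- positive.
  let k := (IsMultiperiodicSeq.exists per
    fun i => if h : i ∈ Finset.Iio r then v ⟨i, h⟩ else 0).choose
  if ((r : ℕ) : ℕ∞) ≤ k t then decimatedPos k r t else 0

theorem IsMultiperiodicSeq.seedPos_eq {per : ℕ+ → ℕ+} {s : ℕ+ → ℕ} {k : ℕ+ → ℕ∞}
    (h : IsMultiperiodicSeq per s k) (r t : ℕ+) :
    seedPos per r t (fun i => s i) = if ((r : ℕ) : ℕ∞) ≤ k t then decimatedPos k r t else 0 := by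
  have h' := (IsMultiperiodicSeq.exists per
    fun i => if h : i ∈ Finset.Iio r then s i else 0).choose_spec
  set k' := (IsMultiperiodicSeq.exists per
    fun i => if h : i ∈ Finset.Iio r then s i else 0).choose with hk'
  have hiff : ∀ u ≤ t, ((r : ℕ) : ℕ∞) ≤ k' u ↔ ((r : ℕ) : ℕ∞) ≤ k u := by
    obtain ⟨m, hm⟩ : ∃ m, (r : ℕ) = m + 1 := ⟨r.natPred, (PNat.natPred_add_one r).symm⟩
    rw [hm]
    refine h'.le_iff_le h t m fun i hi => Or.inl ?_
    rw [dif_pos]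
    rw [Finset.mem_Iio, ← PNat.coe_lt_coe]
    omega
  change (if ((r : ℕ) : ℕ∞) ≤ k' t then decimatedPos k' r t else 0) = _
  rw [decimatedPos_congr hiff]
  simp only [hiff t le_rfl]

variable {per : ℕ+ → ℕ+} {K : ℕ+ → Ω → ℕ∞}

/-- The position among tokens at least `r` is a function of the seeds below `r`, so it is
independent of the seed of `r`, which hits any given residue with probability `1 / per r`. -/
theorem IsMultiperiodicProcess.measure_eq [IsProbabilityMeasure μ]
    (hK : IsMultiperiodicProcess μ per K) (r t : ℕ+) :
    μ {ω | K t ω = ((r : ℕ) : ℕ∞)} =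
      μ {ω | ((r : ℕ) : ℕ∞) ≤ K t ω} * ((per r : ℕ) : ℝ≥0∞)⁻¹ := by
  obtain ⟨s, hsm, hsi, hsu, hs⟩ := hK.exists_seeds
  set G : Ω → ℕ := fun ω => seedPos per r t fun i => s i ω with hG
  have hGae : ∀ᵐ ω ∂μ, G ω = if ((r : ℕ) : ℕ∞) ≤ K t ω
      then decimatedPos (fun t => K t ω) r t else 0 := by
    filter_upwards [hs] with ω hω
    exact hω.seedPos_eq r t
  have hGm : Measurable G :=
    (Measurable.of_discrete (f := seedPos per r t)).comp (measurable_pi_lambda _ fun i => hsm i)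
  have hind : IndepFun G (s r) μ := by
    have := hsi.indepFun_finset (Finset.Iio r) {r} (by simp) hsm
    exact this.comp (φ := seedPos per r t) (ψ := fun v => v ⟨r, by simp⟩)
      Measurable.of_discrete Measurable.of_discrete
  have h1 : μ {ω | K t ω = ((r : ℕ) : ℕ∞)} =
      μ (⋃ m ∈ Finset.Icc 1 (t : ℕ), (G ⁻¹' {m} ∩ s r ⁻¹' {j | m ≡ j [MOD (per r : ℕ)]})) := by
    refine measure_congr ?_
    filter_upwards [hGae, hs] with ω hω hseq
    refine propext ⟨fun h => ?_, fun h => ?_⟩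
    · change K t ω = _ at h
      rw [if_pos h.ge] at hω
      change ω ∈ ⋃ m ∈ Finset.Icc 1 (t : ℕ), (G ⁻¹' {m} ∩ s r ⁻¹' {j | m ≡ j [MOD (per r : ℕ)]})
      refine Set.mem_biUnion (x := G ω) ?_ ⟨rfl, ?_⟩
      · rw [hω]
        exact Finset.mem_coe.2 (Finset.mem_Icc.2
          ⟨decimatedPos_pos (k := fun t => K t ω) h.ge, decimatedPos_le _ _ _⟩)
      · change G ω ≡ s r ω [MOD _]
        rw [hω]
        exact (hseq.eq_iff r t h.ge).1 h
    · obtain ⟨m, hm, h1, h2⟩ := Set.mem_iUnion₂.1 h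
      change G ω = m at h1
      change m ≡ s r ω [MOD _] at h2
      rw [Finset.mem_Icc] at hm
      rw [← h1, hω] at h2
      rw [hω] at h1
      by_cases hle : ((r : ℕ) : ℕ∞) ≤ K t ω
      · rw [if_pos hle] at h2
        exact (hseq.eq_iff r t hle).2 h2
      · rw [if_neg hle] at h1
        omega
  have h2 : μ {ω | ((r : ℕ) : ℕ∞) ≤ K t ω} = ∑ m ∈ Finset.Icc 1 (t : ℕ), μ (G ⁻¹' {m}) := by
    rw [sum_measure_preimage_singleton _ fun m _ => hGm (measurableSet_singleton m)]
    refine measure_congr ?_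
    filter_upwards [hGae] with ω hω
    change (((r : ℕ) : ℕ∞) ≤ K t ω) = (G ω ∈ ((Finset.Icc 1 (t : ℕ) : Finset ℕ) : Set ℕ))
    rw [hω]
    by_cases hle : ((r : ℕ) : ℕ∞) ≤ K t ω
    · have := decimatedPos_pos (k := fun t => K t ω) hle
      simp only [hle, if_true, Finset.mem_coe, Finset.mem_Icc, decimatedPos_le, and_true]
      exact propext ⟨fun _ => this, fun _ => trivial⟩
    · simp [hle]
  rw [h1, h2, measure_biUnion_finset, Finset.sum_mul]
  · refine Finset.sum_congr rfl fun m _ => ?_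
    rw [hind.measure_inter_preimage_eq_mul _ _ (measurableSet_singleton m)
      MeasurableSet.of_discrete]
    congr 1
    exact measure_modEq_of_uniform (per r).pos (hsm r) (hsu r) m
  · intro a _ b _ hab
    exact (Disjoint.preimage G (Set.disjoint_singleton.2 hab)).mono inter_subset_left
      inter_subset_left
  · exact fun m _ => (hGm (measurableSet_singleton m)).inter (hsm r MeasurableSet.of_discrete)

theorem IsMultiperiodicProcess.one_le (hK : IsMultiperiodicProcess μ per K) :
    ∀ᵐ ω ∂μ, ∀ t, 1 ≤ K t ω := by
  obtain ⟨s, -, -, -, hs⟩ := hK.exists_seeds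
  filter_upwards [hs] with ω hω using hω.one_le

theorem IsMultiperiodicProcess.measureReal_add_one_le [IsProbabilityMeasure μ]
    (hK : IsMultiperiodicProcess μ per K) (t : ℕ+) (n : ℕ) :
    μ.real {ω | ((n + 1 : ℕ) : ℕ∞) ≤ K t ω} = tailProb per n := by
  induction n with
  | zero =>
    rw [tailProb, Finset.range_zero, Finset.prod_empty, measureReal_def]
    have : μ {ω | ((0 + 1 : ℕ) : ℕ∞) ≤ K t ω} = 1 := by
      rw [← measure_univ (μ := μ)]
      refine measure_congr ?_
      filter_upwards [hK.one_le] with ω hω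
      exact eq_true (show ((0 + 1 : ℕ) : ℕ∞) ≤ K t ω by simpa using hω t)
    rw [this]; rfl
  | succ n ih =>
    have hm : MeasurableSet {ω | K t ω = ((n + 1 : ℕ) : ℕ∞)} :=
      hK.measurable t (measurableSet_singleton _)
    have hsplit : {ω | ((n + 1 + 1 : ℕ) : ℕ∞) ≤ K t ω} =
        {ω | ((n + 1 : ℕ) : ℕ∞) ≤ K t ω} \ {ω | K t ω = ((n + 1 : ℕ) : ℕ∞)} := by
      ext ω
      exact ENat.add_one_le_iff_le_and_ne
    have heq := congrArg ENNReal.toReal (hK.measure_eq n.succPNat t)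
    rw [ENNReal.toReal_mul, ENNReal.toReal_inv, ENNReal.toReal_natCast] at heq
    simp only [Nat.succPNat_coe, Nat.succ_eq_add_one] at heq
    rw [hsplit, measureReal_sdiff (s₁ := {ω | ((n + 1 : ℕ) : ℕ∞) ≤ K t ω}) (s₂ := {ω | K t ω = ((n + 1 : ℕ) : ℕ∞)})
      (fun ω (hω : K t ω = ((n + 1 : ℕ) : ℕ∞)) => hω.ge) hm, tailProb,
      Finset.prod_range_succ, ← tailProb, ← ih, measureReal_def, measureReal_def, heq]
    ring

theorem IsMultiperiodicProcess.measureReal_eq [IsProbabilityMeasure μ]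
    (hK : IsMultiperiodicProcess μ per K) (t : ℕ+) (n : ℕ) :
    μ.real {ω | K t ω = ((n + 1 : ℕ) : ℕ∞)} =
      tailProb per n * ((per n.succPNat : ℕ) : ℝ)⁻¹ := by
  have heq := congrArg ENNReal.toReal (hK.measure_eq n.succPNat t)
  rw [ENNReal.toReal_mul, ENNReal.toReal_inv, ENNReal.toReal_natCast] at heq
  rw [← hK.measureReal_add_one_le t]
  exact heq

/-- The tokens of a multiperiodic process are identically distributed. -/
theorem IsMultiperiodicProcess.map_eq [IsProbabilityMeasure μ]
    (hK : IsMultiperiodicProcess μ per K) (t u : ℕ+) : μ.map (K t) = μ.map (K u) := by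
  have hcoe : ∀ n : ℕ, μ.map (K t) {(n : ℕ∞)} = μ.map (K u) {(n : ℕ∞)} := by
    intro n
    rw [Measure.map_apply (hK.measurable t) (measurableSet_singleton _),
      Measure.map_apply (hK.measurable u) (measurableSet_singleton _)]
    cases n with
    | zero =>
      have h0 : ∀ v, μ (K v ⁻¹' {((0 : ℕ) : ℕ∞)}) = 0 := by
        intro v
        refine measure_mono_null ?_ (ae_iff.1 hK.one_le)
        intro ω hω
        have : K v ω = 0 := hω
        exact fun h => absurd (h v) (by simp [this])
      rw [h0, h0]
    | succ n =>
      have := (hK.measureReal_eq t n).trans (hK.measureReal_eq u n).symm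
      exact (ENNReal.toReal_eq_toReal_iff' (measure_ne_top _ _) (measure_ne_top _ _)).1 this
  have : ∀ v, IsProbabilityMeasure (μ.map (K v)) := fun v =>
    Measure.isProbabilityMeasure_map (hK.measurable v).aemeasurable
  have hrange : ∀ v, μ.map (K v) {⊤} = 1 - ∑' n : ℕ, μ.map (K v) {(n : ℕ∞)} := by
    intro v
    rw [← measure_iUnion (fun a b hab => by simpa using hab) fun _ => measurableSet_singleton _,
      ← prob_compl_eq_one_sub MeasurableSet.of_discrete]
    congr 1
    ext x
    induction x using ENat.recTopCoe <;> simp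
  refine Measure.ext_of_singleton fun x => ?_
  induction x using ENat.recTopCoe with
  | top => rw [hrange, hrange]; simp only [hcoe]
  | coe n => exact hcoe n

theorem IsMultiperiodicProcess.expectedPow_eq [IsProbabilityMeasure μ]
    (hK : IsMultiperiodicProcess μ per K) (t u : ℕ+) (a : ℝ) :
    expectedPow μ (K t) a = expectedPow μ (K u) a := by
  have h : ∀ v, expectedPow μ (K v) a = ∫⁻ x, (x : ℝ≥0∞) ^ a ∂(μ.map (K v)) := fun v =>
    (lintegral_map (f := fun x : ℕ∞ => (x : ℝ≥0∞) ^ a) Measurable.of_discrete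
      (hK.measurable v)).symm
  rw [h, h, hK.map_eq t u]

end

/-! ### Gibbs' inequality and summable weights -/

/-- This is `log x ≤ x - 1` at `x = w / p`. The term `p` stays on the left so that sums over atoms
need no subtraction in `ℝ≥0∞`. -/
theorem negMulLog_add_le {p w : ℝ} (hp : 0 ≤ p) (hw : 0 < w) :
    negMulLog p + p ≤ p * (-log w) + w := by
  rcases hp.eq_or_lt with rfl | hp
  · simpa using hw.le
  have h := mul_le_mul_of_nonneg_left (log_le_sub_one_of_pos (div_pos hw hp)) hp.le
  rw [log_div hw.ne' hp.ne'] at h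
  have h2 : p * (w / p - 1) = w - p := by field_simp
  rw [h2] at h
  rw [negMulLog]
  linarith

section

variable {Ω : Type*} [MeasurableSpace Ω] {μ : Measure Ω}

theorem lintegral_comp_eq_tsum {α : Type*} [Countable α] [MeasurableSpace α]
    [DiscreteMeasurableSpace α] {X : Ω → α} (hX : Measurable X) (g : α → ℝ≥0∞) :
    ∫⁻ ω, g (X ω) ∂μ = ∑' x, g x * μ {ω | X ω = x} := by
  rw [← lintegral_map (Measurable.of_discrete) hX, lintegral_countable']
  refine tsum_congr fun x => ?_
  rw [Measure.map_apply hX (measurableSet_singleton x)]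
  rfl

/-- Gibbs' inequality. -/
theorem shannonEntropy_le_lintegral [IsProbabilityMeasure μ] {α : Type*} [Countable α]
    [MeasurableSpace α] [DiscreteMeasurableSpace α] {X : Ω → α} (hX : Measurable X) {S : Set α}
    (hS : ∀ᵐ ω ∂μ, X ω ∈ S) (w : α → ℝ) (hw : ∀ x ∈ S, 0 < w x)
    (hsum : ∑' x : S, ENNReal.ofReal (w x) ≤ 1) :
    shannonEntropy μ X ≤ ∫⁻ ω, ENNReal.ofReal (-log (w (X ω))) ∂μ := by
  have hone : ∑' x, μ {ω | X ω = x} = 1 := by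
    have := lintegral_comp_eq_tsum (μ := μ) hX fun _ => 1
    simpa using this.symm
  have hpt : ∀ x, ENNReal.ofReal (negMulLog (μ.real {ω | X ω = x})) + μ {ω | X ω = x} ≤
      ENNReal.ofReal (-log (w x)) * μ {ω | X ω = x} +
        S.indicator (fun x => ENNReal.ofReal (w x)) x := by
    intro x
    have hμ : μ {ω | X ω = x} = ENNReal.ofReal (μ.real {ω | X ω = x}) := by simp
    by_cases hx : x ∈ S
    · rw [Set.indicator_of_mem hx, hμ, ← ENNReal.ofReal_add (negMulLog_nonneg measureReal_nonneg
        measureReal_le_one) measureReal_nonneg, mul_comm, ← ENNReal.ofReal_mul measureReal_nonneg]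
      refine le_trans (ENNReal.ofReal_le_ofReal ?_) ENNReal.ofReal_add_le
      exact negMulLog_add_le measureReal_nonneg (hw x hx)
    · have h0 : μ {ω | X ω = x} = 0 := by
        refine measure_mono_null ?_ (ae_iff.1 hS)
        intro ω (hω : X ω = x)
        exact fun h => hx (hω ▸ h)
      simp [measureReal_def, h0]
  have h := ENNReal.tsum_le_tsum hpt
  rw [ENNReal.tsum_add, ENNReal.tsum_add, hone, ← lintegral_comp_eq_tsum hX, ← tsum_subtype] at h
  -- The total probability `1` on the left cancels against the bound `1` for the total weight.
  exact (ENNReal.add_le_add_iff_right ENNReal.one_ne_top).1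
    (h.trans (add_le_add_right hsum _))

end

/-- Expanding `∏ (1 + a i)` lists all subsets, and `1 + a ≤ exp a`. With `c = 1` it normalises the
code for sets of pairs at the cost of one nat. -/
theorem tsum_finset_prod_le {ι : Type*} {a : ι → ℝ} (ha : ∀ i, 0 ≤ a i) {c : ℝ}
    (hc : ∀ s : Finset ι, ∑ i ∈ s, a i ≤ c) :
    ∑' A : Finset ι, ENNReal.ofReal (∏ i ∈ A, a i) ≤ ENNReal.ofReal (exp c) := by
  classical
  rw [ENNReal.tsum_eq_iSup_sum]
  refine iSup_le fun F => ?_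
  rw [← ENNReal.ofReal_sum_of_nonneg fun A _ => Finset.prod_nonneg fun i _ => ha i]
  refine ENNReal.ofReal_le_ofReal ?_
  calc ∑ A ∈ F, ∏ i ∈ A, a i ≤ ∑ A ∈ (F.sup id).powerset, ∏ i ∈ A, a i :=
        Finset.sum_le_sum_of_subset_of_nonneg
          (fun A hA => Finset.mem_powerset.2 (Finset.le_sup (f := id) hA))
          fun A _ _ => Finset.prod_nonneg fun i _ => ha i
    _ = ∏ i ∈ F.sup id, (1 + a i) := (Finset.prod_one_add _).symm
    _ ≤ ∏ i ∈ F.sup id, exp (a i) :=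
        Finset.prod_le_prod (fun i _ => by linarith [ha i])
          fun i _ => by linarith [add_one_le_exp (a i)]
    _ = exp (∑ i ∈ F.sup id, a i) := (exp_sum _ _).symm
    _ ≤ exp c := exp_le_exp.2 (hc _)

/-- The term `r = 0` is `0⁻¹ = 0`; the rest telescopes. -/
theorem sum_range_inv_mul_add_one (n : ℕ) :
    ∑ r ∈ Finset.range (n + 1), ((r : ℝ) * (r + 1))⁻¹ = 1 - ((n : ℝ) + 1)⁻¹ := by
  induction n with
  | zero => simp
  | succ n ih =>
    rw [Finset.sum_range_succ, ih]
    push_cast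
    field_simp
    ring

theorem sum_inv_mul_add_one_le (s : Finset ℕ) : ∑ r ∈ s, ((r : ℝ) * (r + 1))⁻¹ ≤ 1 := by
  calc ∑ r ∈ s, ((r : ℝ) * (r + 1))⁻¹
      ≤ ∑ r ∈ Finset.range (s.sup id + 1), ((r : ℝ) * (r + 1))⁻¹ :=
        Finset.sum_le_sum_of_subset_of_nonneg
          (fun r hr => Finset.mem_range_succ_iff.2 (Finset.le_sup (f := id) hr))
          fun r _ _ => by positivity
    _ ≤ 1 := by
      rw [sum_range_inv_mul_add_one]
      have : 0 < (((s.sup id : ℕ) : ℝ) + 1)⁻¹ := by positivity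
      linarith

theorem sum_prod_fin_inv_le (T : ℕ) (s : Finset (ℕ × Fin T)) :
    ∑ p ∈ s, ((T : ℝ) * ((p.1 : ℝ) * (p.1 + 1)))⁻¹ ≤ 1 := by
  classical
  rcases Nat.eq_zero_or_pos T with rfl | hT
  · simp
  calc ∑ p ∈ s, ((T : ℝ) * ((p.1 : ℝ) * (p.1 + 1)))⁻¹
      ≤ ∑ p ∈ s.image Prod.fst ×ˢ Finset.univ, ((T : ℝ) * ((p.1 : ℝ) * (p.1 + 1)))⁻¹ :=
        Finset.sum_le_sum_of_subset_of_nonneg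
          (fun p hp => Finset.mem_product.2 ⟨Finset.mem_image_of_mem _ hp, Finset.mem_univ _⟩)
          fun r _ _ => by positivity
    _ = ∑ r ∈ s.image Prod.fst, ((r : ℝ) * (r + 1))⁻¹ := by
      rw [Finset.sum_product]
      refine Finset.sum_congr rfl fun r _ => ?_
      simp only []
      rw [Finset.sum_const, Finset.card_univ, Fintype.card_fin, nsmul_eq_mul, mul_inv, ← mul_assoc,
        mul_inv_cancel₀ (by exact_mod_cast hT.ne'), one_mul]
    _ ≤ 1 := sum_inv_mul_add_one_le _

/-! ### Encoding a block by first occurrences -/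

section FirstTimes

open scoped Classical in
/-- The times of the first occurrences of the finite types in a block. -/
noncomputable def firstTimes {T : ℕ} (x : Fin T → ℕ∞) : Finset (Fin T) :=
  Finset.univ.filter fun t => x t ≠ ⊤ ∧ ∀ s < t, x s ≠ x t

theorem mem_firstTimes {T : ℕ} {x : Fin T → ℕ∞} {t : Fin T} :
    t ∈ firstTimes x ↔ x t ≠ ⊤ ∧ ∀ s < t, x s ≠ x t := by simp [firstTimes]

theorem exists_mem_firstTimes {T : ℕ} {x : Fin T → ℕ∞} {i : Fin T} (hi : x i ≠ ⊤) :
    ∃ t ∈ firstTimes x, x t = x i := by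
  obtain ⟨t, ht⟩ := (Finset.univ.filter fun t => x t = x i).exists_minimal ⟨i, by simp⟩
  have hti : x t = x i := (Finset.mem_filter.1 ht.1).2
  refine ⟨t, mem_firstTimes.2 ⟨hti ▸ hi, fun s hs hst => ?_⟩, hti⟩
  exact absurd (ht.2 (Finset.mem_filter.2 ⟨Finset.mem_univ s, hst.trans hti⟩) hs.le) (not_le.2 hs)

theorem injOn_firstTimes {T : ℕ} (x : Fin T → ℕ∞) : Set.InjOn x (firstTimes x) := by
  intro s hs t ht e
  rcases lt_trichotomy s t with h | h | h
  · exact absurd e ((mem_firstTimes.1 ht).2 s h)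
  · exact h
  · exact absurd e.symm ((mem_firstTimes.1 hs).2 t h)

/-- The set of the types of a block with the times of their first occurrences. -/
noncomputable def firstOccurrences {T : ℕ} (x : Fin T → ℕ∞) : Finset (ℕ × Fin T) :=
  (firstTimes x).image fun t => ((x t).toNat, t)

theorem mem_firstOccurrences {T : ℕ} {x : Fin T → ℕ∞} {r : ℕ} {t : Fin T} :
    (r, t) ∈ firstOccurrences x ↔ t ∈ firstTimes x ∧ x t = r := by
  simp only [firstOccurrences, Finset.mem_image, Prod.mk.injEq]
  constructor
  · rintro ⟨u, hu, h1, rfl⟩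
    exact ⟨hu, by rw [← h1, ENat.natCast_toNat (mem_firstTimes.1 hu).1]⟩
  · rintro ⟨h1, h2⟩
    exact ⟨t, h1, by simp [h2], rfl⟩

theorem prod_firstOccurrences {T : ℕ} (x : Fin T → ℕ∞) (f : ℕ × Fin T → ℝ) :
    ∏ p ∈ firstOccurrences x, f p = ∏ t ∈ firstTimes x, f ((x t).toNat, t) :=
  Finset.prod_image fun _ _ _ _ e => (Prod.mk.inj e).2

/-- The blocks of length `T` of multiperiodic sequences in which all tokens are finite. -/
def finiteBlocks (per : ℕ+ → ℕ+) (T : ℕ) : Set (Fin T → ℕ∞) :=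
  {x | ∃ s k, IsMultiperiodicSeq per s k ∧ ∀ i : Fin T, x i = k (i : ℕ).succPNat ∧ x i ≠ ⊤}

theorem one_le_toNat_of_mem_finiteBlocks {per : ℕ+ → ℕ+} {T : ℕ} {x : Fin T → ℕ∞}
    (hx : x ∈ finiteBlocks per T) (i : Fin T) : 1 ≤ (x i).toNat := by
  obtain ⟨s, k, hk, hx⟩ := hx
  have h := hk.one_le (i : ℕ).succPNat
  rw [← (hx i).1, ← ENat.natCast_toNat (hx i).2] at h
  exact_mod_cast h

/-- Equal sets of first occurrences supply, for every type of either block, a time at which both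
show it; rigidity does the rest. -/
theorem injOn_firstOccurrences (per : ℕ+ → ℕ+) (T : ℕ) :
    Set.InjOn firstOccurrences (finiteBlocks per T) := by
  rintro x ⟨s, k, hk, hx⟩ y ⟨s', k', hk', hy⟩ e
  rcases Nat.eq_zero_or_pos T with rfl | hT
  · exact Subsingleton.elim _ _
  have hidx : ∀ t : ℕ+, t ≤ (⟨T, hT⟩ : ℕ+) → ∃ i : Fin T, (i : ℕ).succPNat = t := by
    intro t ht
    refine ⟨⟨t.natPred, ?_⟩, PNat.succPNat_natPred t⟩
    have h1 : (t : ℕ) ≤ T := ht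
    have := PNat.natPred_add_one t
    omega
  have hle : ∀ i : Fin T, (i : ℕ).succPNat ≤ (⟨T, hT⟩ : ℕ+) := fun i => i.2
  have main := hk.eq_of_occurrences hk' ⟨T, hT⟩ (fun t ht => by
    obtain ⟨i, rfl⟩ := hidx t ht
    rw [← (hx i).1]; exact (hx i).2) fun r t ht h => by
      obtain ⟨i, rfl⟩ := hidx t ht
      rw [← (hx i).1, ← (hy i).1] at h
      have key : ∃ j, x j = ((r : ℕ) : ℕ∞) ∧ y j = ((r : ℕ) : ℕ∞) := by
        rcases h with h | h
        · obtain ⟨j, hj, hji⟩ := exists_mem_firstTimes (x := x) (i := i) (hx i).2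
          have : ((r : ℕ), j) ∈ firstOccurrences x := mem_firstOccurrences.2 ⟨hj, hji.trans h⟩
          exact ⟨j, hji.trans h, (mem_firstOccurrences.1 (e ▸ this)).2⟩
        · obtain ⟨j, hj, hji⟩ := exists_mem_firstTimes (x := y) (i := i) (hy i).2
          have : ((r : ℕ), j) ∈ firstOccurrences y := mem_firstOccurrences.2 ⟨hj, hji.trans h⟩
          exact ⟨j, (mem_firstOccurrences.1 (e ▸ this)).2, hji.trans h⟩
      obtain ⟨j, hj1, hj2⟩ := key
      exact ⟨_, hle j, by rw [← (hx j).1, hj1], by rw [← (hy j).1, hj2]⟩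
  funext i
  rw [(hx i).1, (hy i).1]
  exact main _ (hle i)

/-- Tangent to the logarithm at `x ^ (1 / q) = a`. Being affine in `x ^ (1 / q)`, it replaces
Jensen's inequality for sums over a random set of times. -/
theorem log_le_of_rpow {q a x : ℝ} (hq : 0 < q) (ha : 0 < a) (hx : 0 < x) :
    log x ≤ q * (log a - 1) + q / a * x ^ (1 / q) := by
  have h := log_le_sub_one_of_pos (div_pos (rpow_pos_of_pos hx (1 / q)) ha)
  rw [log_div (rpow_pos_of_pos hx _).ne' ha.ne', log_rpow hx] at h
  have h2 := mul_le_mul_of_nonneg_left h hq.le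
  have h3 : q * (1 / q * log x - log a) = log x - q * log a := by field_simp
  have h4 : q / a * x ^ (1 / q) = q * (x ^ (1 / q) / a) := by ring
  rw [h4]
  linarith

end FirstTimes

/-! ### Expected number of types and moments -/

section

variable {Ω : Type*} [MeasurableSpace Ω] {μ : Measure Ω} {per : ℕ+ → ℕ+} {K : ℕ+ → Ω → ℕ∞}

theorem measurable_block {α : Type*} [MeasurableSpace α] {X : ℕ+ → Ω → α}
    (hX : ∀ t, Measurable (X t)) (T : ℕ) : Measurable (block X T) :=
  measurable_pi_lambda _ fun _ => hX _

/-- The token `0` is not a type. It can only appear on a null event, but is filtered out to keep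
this identity pointwise. -/
theorem ncard_typeSet_eq_card_image {T : ℕ} {ω : Ω} :
    (typeSet K T ω).ncard =
      (((firstTimes (block K T ω)).filter fun t => block K T ω t ≠ 0)).card := by
  rw [← Set.ncard_coe_finset]
  symm
  refine Set.ncard_congr (fun t _ => ((block K T ω t).toNat).toPNat') ?_ ?_ ?_
  · intro t ht
    rw [Finset.coe_filter] at ht
    obtain ⟨h1, h2⟩ := ht
    obtain ⟨n, hn⟩ := ENat.ne_top_iff_exists.1 (mem_firstTimes.1 h1).1
    refine ⟨(t : ℕ).succPNat, t.2, ?_⟩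
    change block K T ω t = _
    rw [← hn] at h2 ⊢
    have : 0 < n := Nat.pos_of_ne_zero (by simpa using h2)
    rw [ENat.toNat_natCast, Nat.toPNat'_coe, if_pos this]
  · intro s t hs ht e
    rw [Finset.coe_filter] at hs ht
    refine injOn_firstTimes (block K T ω) hs.1 ht.1 ?_
    obtain ⟨n, hn⟩ := ENat.ne_top_iff_exists.1 (mem_firstTimes.1 hs.1).1
    obtain ⟨m, hm⟩ := ENat.ne_top_iff_exists.1 (mem_firstTimes.1 ht.1).1
    have hs2 := hs.2
    have ht2 := ht.2
    rw [← hn] at e hs2 ⊢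
    rw [← hm] at e ht2 ⊢
    have h1 : 0 < n := Nat.pos_of_ne_zero (by simpa using hs2)
    have h2 : 0 < m := Nat.pos_of_ne_zero (by simpa using ht2)
    have := congrArg PNat.val e
    simpa [h1, h2] using this
  · rintro r ⟨u, hu, hur⟩
    have hi : u.natPred < T := by have := PNat.natPred_add_one u; omega
    have hxi : block K T ω ⟨u.natPred, hi⟩ = ((r : ℕ) : ℕ∞) := by
      simp only [block, PNat.succPNat_natPred, hur]
    obtain ⟨t, ht, hti⟩ := exists_mem_firstTimes (x := block K T ω) (i := ⟨u.natPred, hi⟩)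
      (by rw [hxi]; exact ENat.natCast_ne_top _)
    rw [hxi] at hti
    refine ⟨t, ?_, ?_⟩
    · rw [Finset.coe_filter]
      exact ⟨ht, by rw [hti]; exact_mod_cast r.pos.ne'⟩
    · simp only [hti, ENat.toNat_natCast]
      exact PNat.eq (by simp)

theorem ncard_typeSet_eq {T : ℕ} {ω : Ω} (h : ∀ t, 1 ≤ K t ω) :
    (typeSet K T ω).ncard = (firstTimes (block K T ω)).card := by
  rw [ncard_typeSet_eq_card_image, Finset.filter_true_of_mem]
  intro t _ e
  have h1 := h (t : ℕ).succPNat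
  have h2 : K (t : ℕ).succPNat ω = 0 := e
  simp [h2] at h1

theorem IsMultiperiodicProcess.expectedTypes_eq (hK : IsMultiperiodicProcess μ per K) (T : ℕ) :
    expectedTypes μ K T = ∫ ω, ((firstTimes (block K T ω)).card : ℝ) ∂μ := by
  refine integral_congr_ae ?_
  filter_upwards [hK.one_le] with ω hω
  rw [ncard_typeSet_eq hω]

theorem IsMultiperiodicProcess.integrable_card [IsProbabilityMeasure μ]
    (hK : IsMultiperiodicProcess μ per K) (T : ℕ) :
    Integrable (fun ω => ((firstTimes (block K T ω)).card : ℝ)) μ := by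
  refine Integrable.of_bound (C := T) ?_ ?_
  · exact ((Measurable.of_discrete (f := fun x : Fin T → ℕ∞ => ((firstTimes x).card : ℝ))).comp
      (measurable_block hK.measurable T)).aestronglyMeasurable
  · refine Eventually.of_forall fun ω => ?_
    rw [Real.norm_of_nonneg (Nat.cast_nonneg _)]
    exact_mod_cast (Finset.card_le_univ _).trans (by simp)

theorem IsMultiperiodicProcess.ae_ne_top (hK : IsMultiperiodicProcess μ per K) {t : ℕ+} {a : ℝ}
    (ha : 0 < a) (h : expectedPow μ (K t) a ≠ ∞) : ∀ᵐ ω ∂μ, K t ω ≠ ⊤ := by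
  have hm : Measurable fun ω => (K t ω : ℝ≥0∞) ^ a :=
    (Measurable.of_discrete (f := fun x : ℕ∞ => (x : ℝ≥0∞) ^ a)).comp (hK.measurable t)
  filter_upwards [ae_lt_top hm h] with ω hω e
  simp [e, ENNReal.top_rpow_of_pos ha] at hω

/-- Identical distribution moves the moment from time `t` to any `u`. That `toNat` sends `∞` to `0`
is harmless, since a finite moment excludes `∞` almost surely. -/
theorem IsMultiperiodicProcess.integral_rpow [IsProbabilityMeasure μ]
    (hK : IsMultiperiodicProcess μ per K) {t u : ℕ+} {a : ℝ}
    (ha : 0 < a) (h : expectedPow μ (K t) a ≠ ∞) :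
    Integrable (fun ω => ((K u ω).toNat : ℝ) ^ a) μ ∧
      ∫ ω, ((K u ω).toNat : ℝ) ^ a ∂μ = (expectedPow μ (K t) a).toReal := by
  rw [hK.expectedPow_eq t u] at h ⊢
  have hfin := hK.ae_ne_top ha h
  have hm : Measurable fun ω => ((K u ω).toNat : ℝ) ^ a :=
    (Measurable.of_discrete (f := fun x : ℕ∞ => ((x.toNat : ℕ) : ℝ) ^ a)).comp (hK.measurable u)
  have hnn : 0 ≤ᵐ[μ] fun ω => ((K u ω).toNat : ℝ) ^ a :=
    Eventually.of_forall fun ω => rpow_nonneg (Nat.cast_nonneg _) _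
  have heq : ∫⁻ ω, ENNReal.ofReal (((K u ω).toNat : ℝ) ^ a) ∂μ = expectedPow μ (K u) a := by
    refine lintegral_congr_ae ?_
    filter_upwards [hfin] with ω hω
    obtain ⟨n, hn⟩ := ENat.ne_top_iff_exists.1 hω
    rw [← hn, ENat.toNat_natCast, ← ENNReal.ofReal_rpow_of_nonneg (Nat.cast_nonneg _) ha.le]
    simp
  constructor
  · refine ⟨hm.aestronglyMeasurable, ?_⟩
    rw [hasFiniteIntegral_iff_ofReal hnn, heq]
    exact lt_top_iff_ne_top.2 h
  · rw [integral_eq_lintegral_of_nonneg_ae hnn hm.aestronglyMeasurable, heq]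

theorem IsMultiperiodicProcess.one_le_expectedPow [IsProbabilityMeasure μ]
    (hK : IsMultiperiodicProcess μ per K) (t : ℕ+) {a : ℝ} (ha : 0 < a) :
    1 ≤ expectedPow μ (K t) a := by
  calc (1 : ℝ≥0∞) = ∫⁻ _, 1 ∂μ := by simp
    _ ≤ expectedPow μ (K t) a := by
      refine lintegral_mono_ae ?_
      filter_upwards [hK.one_le] with ω hω
      exact ENNReal.one_le_rpow (by exact_mod_cast hω t) ha

end

/-! ### Upper bound for the entropy of `K` -/

theorem log_cost_le {q a : ℝ} (hq : 0 < q) (ha : 0 < a) {T n : ℕ} (hT : 1 ≤ T) (hn : 1 ≤ n) :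
    log ((T : ℝ) * ((n : ℝ) * (n + 1))) ≤
      (log T + log 2 + 2 * (q * (log a - 1))) + 2 * (q / a) * (n : ℝ) ^ (1 / q) := by
  have hT' : (0 : ℝ) < T := by exact_mod_cast hT
  have hn' : (1 : ℝ) ≤ n := by exact_mod_cast hn
  have hn0 : (0 : ℝ) < n := by linarith
  have h1 : log ((n : ℝ) + 1) ≤ log 2 + log n := by
    rw [← log_mul two_ne_zero hn0.ne']
    exact log_le_log (by linarith) (by linarith)
  have h2 := log_le_of_rpow hq ha hn0
  rw [log_mul hT'.ne' (by positivity), log_mul hn0.ne' (by positivity)]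
  linarith

/-- Needed for blocks of length one: the gain `-log 2` for `n ≥ 2` will pay for the cost `log 2` at
`n = 1`, whose probability is at most one half unless it is one. -/
theorem log_mul_add_one_le {n : ℕ} (hn : 1 ≤ n) :
    log ((n : ℝ) * (n + 1)) ≤ 4 * log n + log 2 * (2 * (if n = 1 then 1 else 0) - 1) := by
  by_cases h : n = 1
  · subst h
    norm_num
  · have h2 : 2 ≤ n := by omega
    have h2' : (2 : ℝ) ≤ n := by exact_mod_cast h2
    rw [if_neg h]
    have h3 : log ((n : ℝ) * (n + 1)) + log 2 ≤ 4 * log n := by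
      rw [← log_mul (by positivity) two_ne_zero,
        show (4 : ℝ) * log n = log ((n : ℝ) ^ 4) by rw [log_pow]; norm_num]
      refine log_le_log (by positivity) ?_
      have : 0 ≤ ((n : ℝ) - 2) * n := by nlinarith
      nlinarith [mul_nonneg this (sq_nonneg (n : ℝ)), mul_nonneg this (by linarith : (0 : ℝ) ≤ n)]
    linarith

section

variable {Ω : Type*} [MeasurableSpace Ω] {μ : Measure Ω} {per : ℕ+ → ℕ+} {K : ℕ+ → Ω → ℕ∞}

theorem IsMultiperiodicProcess.ae_mem_finiteBlocks [IsProbabilityMeasure μ]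
    (hK : IsMultiperiodicProcess μ per K) {t : ℕ+} {a : ℝ} (ha : 0 < a)
    (h : expectedPow μ (K t) a ≠ ∞) (T : ℕ) : ∀ᵐ ω ∂μ, block K T ω ∈ finiteBlocks per T := by
  obtain ⟨s, -, -, -, hs⟩ := hK.exists_seeds
  have hfin : ∀ᵐ ω ∂μ, ∀ u, K u ω ≠ ⊤ := ae_all_iff.2 fun u =>
    hK.ae_ne_top ha (by rwa [hK.expectedPow_eq u t])
  filter_upwards [hs, hfin] with ω hω hω'
  exact ⟨_, _, hω, fun i => ⟨rfl, hω' _⟩⟩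

theorem IsMultiperiodicProcess.one_le_expectedTypes [IsProbabilityMeasure μ]
    (hK : IsMultiperiodicProcess μ per K) {t : ℕ+} {a : ℝ} (ha : 0 < a)
    (h : expectedPow μ (K t) a ≠ ∞) {T : ℕ} (hT : 1 ≤ T) : 1 ≤ expectedTypes μ K T := by
  rw [hK.expectedTypes_eq]
  have h1 : ∫ _ : Ω, (1 : ℝ) ∂μ = 1 := by simp
  rw [← h1]
  refine integral_mono_ae (integrable_const _) (hK.integrable_card T) ?_
  filter_upwards [hK.ae_mem_finiteBlocks ha h T] with ω hω
  obtain ⟨s, k, -, hx⟩ := hω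
  obtain ⟨u, hu, -⟩ := exists_mem_firstTimes (x := block K T ω) (i := ⟨0, hT⟩) (hx _).2
  exact_mod_cast Finset.card_pos.2 ⟨u, hu⟩

theorem IsMultiperiodicProcess.shannonEntropy_le_aux [IsProbabilityMeasure μ]
    (hK : IsMultiperiodicProcess μ per K) {q : ℝ} (hq : 0 < q) {t : ℕ+}
    (h : expectedPow μ (K t) (1 / q) ≠ ∞) {T : ℕ} (hT : 1 ≤ T) :
    shannonEntropy μ (block K T) ≤ ENNReal.ofReal (1 + expectedTypes μ K T *
      (log T + log 2 + 2 * (q * log (T * (expectedPow μ (K t) (1 / q)).toReal)))) := by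
  have hq' : 0 < 1 / q := by positivity
  set m := (expectedPow μ (K t) (1 / q)).toReal with hm
  have hm1 : 1 ≤ m := by
    rw [hm, ← ENNReal.toReal_one]
    exact ENNReal.toReal_mono h (hK.one_le_expectedPow t hq')
  have hT' : (1 : ℝ) ≤ T := by exact_mod_cast hT
  -- The tangent point is the expectation of the sum of `K_i ^ (1 / q)` over all `T` positions.
  set a : ℝ := T * m with ha
  have ha0 : 0 < a := by positivity
  have hmem := hK.ae_mem_finiteBlocks hq' h T
  set f : ℕ × Fin T → ℝ := fun p => ((T : ℝ) * ((p.1 : ℝ) * (p.1 + 1)))⁻¹ with hf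
  have hf0 : ∀ p, 0 ≤ f p := fun p => by simp only [hf]; positivity
  set w : (Fin T → ℕ∞) → ℝ := fun x => exp (-1) * ∏ p ∈ firstOccurrences x, f p with hw
  have hlogw : ∀ x ∈ finiteBlocks per T, 0 < ∏ p ∈ firstOccurrences x, f p ∧ -log (w x) =
      1 + ∑ i ∈ firstTimes x, log ((T : ℝ) * (((x i).toNat : ℝ) * ((x i).toNat + 1))) := by
    intro x hx
    have hpos : ∀ i, 0 < f ((x i).toNat, i) := fun i => by
      have : 0 < (x i).toNat := one_le_toNat_of_mem_finiteBlocks hx i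
      simp only [hf]
      positivity
    have hprod : 0 < ∏ p ∈ firstOccurrences x, f p := by
      rw [prod_firstOccurrences]
      exact Finset.prod_pos fun i _ => hpos i
    refine ⟨hprod, ?_⟩
    simp only [hw]
    rw [log_mul (exp_ne_zero _) hprod.ne', log_exp, prod_firstOccurrences,
      log_prod fun i _ => (hpos i).ne', neg_add, neg_neg, ← Finset.sum_neg_distrib]
    congr 1
    refine Finset.sum_congr rfl fun i _ => ?_
    simp only [hf]
    rw [log_inv, neg_neg]
  have hH := shannonEntropy_le_lintegral (measurable_block hK.measurable T) hmem w
    (fun x hx => mul_pos (exp_pos _) (hlogw x hx).1) (by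
      have h1 : ∀ x : finiteBlocks per T, ENNReal.ofReal (w x) = ENNReal.ofReal (exp (-1)) *
          ENNReal.ofReal (∏ p ∈ firstOccurrences (x : Fin T → ℕ∞), f p) := fun x =>
        ENNReal.ofReal_mul (exp_pos _).le
      simp only [h1]
      rw [ENNReal.tsum_mul_left]
      calc _ ≤ ENNReal.ofReal (exp (-1)) * ∑' A : Finset (ℕ × Fin T),
              ENNReal.ofReal (∏ p ∈ A, f p) := by
            gcongr
            exact ENNReal.tsum_comp_le_tsum_of_injective
              (injOn_firstOccurrences per T).injective fun A => ENNReal.ofReal (∏ p ∈ A, f p)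
        _ ≤ ENNReal.ofReal (exp (-1)) * ENNReal.ofReal (exp 1) := by
            gcongr
            exact tsum_finset_prod_le hf0 (sum_prod_fin_inv_le T)
        _ = 1 := by
            rw [← ENNReal.ofReal_mul (exp_pos _).le, ← exp_add]
            simp)
  set U : Ω → ℝ := fun ω => 1 + ((firstTimes (block K T ω)).card : ℝ) *
    (log T + log 2 + 2 * (q * (log a - 1))) +
      2 * (q / a) * ∑ i : Fin T, ((K (i : ℕ).succPNat ω).toNat : ℝ) ^ (1 / q) with hU
  have hUle : ∀ᵐ ω ∂μ, 0 ≤ -log (w (block K T ω)) ∧ -log (w (block K T ω)) ≤ U ω := by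
    filter_upwards [hmem] with ω hω
    rw [(hlogw _ hω).2]
    have h1 := one_le_toNat_of_mem_finiteBlocks hω
    constructor
    · refine add_nonneg zero_le_one (Finset.sum_nonneg fun i _ => log_nonneg ?_)
      have : (1 : ℝ) ≤ (block K T ω i).toNat := by exact_mod_cast h1 i
      exact one_le_mul_of_one_le_of_one_le hT'
        (one_le_mul_of_one_le_of_one_le this (by linarith))
    · simp only [hU]
      rw [add_assoc]
      refine add_le_add_right ?_ _
      calc _ ≤ ∑ i ∈ firstTimes (block K T ω), ((log T + log 2 + 2 * (q * (log a - 1))) +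
              2 * (q / a) * ((block K T ω i).toNat : ℝ) ^ (1 / q)) :=
            Finset.sum_le_sum fun i _ => log_cost_le hq ha0 hT (h1 i)
        _ ≤ _ := by
            rw [Finset.sum_add_distrib, Finset.sum_const, nsmul_eq_mul, ← Finset.mul_sum]
            refine add_le_add_right (mul_le_mul_of_nonneg_left ?_ (by positivity)) _
            -- Passing from the random first times to all positions makes the expectation
            -- computable.
            exact Finset.sum_le_sum_of_subset_of_nonneg (Finset.subset_univ _)
              fun i _ _ => rpow_nonneg (Nat.cast_nonneg _) _
  have hi1 : Integrable (fun ω => ((firstTimes (block K T ω)).card : ℝ) *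
      (log T + log 2 + 2 * (q * (log a - 1)))) μ := (hK.integrable_card T).mul_const _
  have hi2 : Integrable (fun ω => 2 * (q / a) *
      ∑ i : Fin T, ((K (i : ℕ).succPNat ω).toNat : ℝ) ^ (1 / q)) μ :=
    (integrable_finsetSum _ fun i _ => (hK.integral_rpow hq' h).1).const_mul _
  have hi0 : Integrable (fun ω => 1 + ((firstTimes (block K T ω)).card : ℝ) *
      (log T + log 2 + 2 * (q * (log a - 1)))) μ := (integrable_const _).add hi1
  have hUi : Integrable U μ := hi0.add hi2
  have hUint : ∫ ω, U ω ∂μ = 1 + expectedTypes μ K T * (log T + log 2 + 2 * (q * (log a - 1))) +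
      2 * (q / a) * a := by
    simp only [hU]
    rw [integral_add hi0 hi2, integral_add (integrable_const _) hi1, integral_mul_const,
      integral_const_mul, integral_finsetSum _ fun i _ => (hK.integral_rpow hq' h).1,
      hK.expectedTypes_eq]
    congr 2
    · simp
    · simp only [(hK.integral_rpow hq' h).2]
      simp [ha, hm]
  have hE := hK.one_le_expectedTypes hq' h hT
  calc shannonEntropy μ (block K T) ≤ _ := hH
    _ ≤ ∫⁻ ω, ENNReal.ofReal (U ω) ∂μ := by
        refine lintegral_mono_ae ?_
        filter_upwards [hUle] with ω hω using ENNReal.ofReal_le_ofReal hω.2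
    _ = ENNReal.ofReal (∫ ω, U ω ∂μ) := by
        rw [ofReal_integral_eq_lintegral_ofReal hUi]
        filter_upwards [hUle] with ω hω using hω.1.trans hω.2
    _ ≤ _ := by
        refine ENNReal.ofReal_le_ofReal ?_
        -- The remaining `2 q` is covered by the tangent's `-2 q` per type, as at least one type is
        -- expected.
        rw [hUint, show 2 * (q / a) * a = 2 * q by field_simp]
        nlinarith [mul_le_mul_of_nonneg_right hE hq.le]

/-- At `T = 1` the target has no additive constant to spare, so the token is coded by the weight `1
/ (r (r + 1))` directly, without the loss of a nat. -/
theorem IsMultiperiodicProcess.shannonEntropy_block_one_le [IsProbabilityMeasure μ]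
    (hK : IsMultiperiodicProcess μ per K) {q : ℝ} (hq : 0 < q) {t : ℕ+}
    (h : expectedPow μ (K t) (1 / q) ≠ ∞) :
    shannonEntropy μ (block K 1) ≤
      ENNReal.ofReal (4 * (q * log (expectedPow μ (K t) (1 / q)).toReal)) := by
  have hq' : 0 < 1 / q := by positivity
  set m := (expectedPow μ (K t) (1 / q)).toReal with hm
  have hm1 : 1 ≤ m := by
    rw [hm, ← ENNReal.toReal_one]
    exact ENNReal.toReal_mono h (hK.one_le_expectedPow t hq')
  have hm0 : 0 < m := by linarith
  have hmem := hK.ae_mem_finiteBlocks hq' h 1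
  have hp1 : μ.real {ω | K 1 ω = ((0 + 1 : ℕ) : ℕ∞)} = ((per 1 : ℕ) : ℝ)⁻¹ := by
    rw [hK.measureReal_eq]
    simp [tailProb]
    rfl
  -- With period `1` every token is `1` and the entropy vanishes; otherwise `P(K_1 = 1) ≤ 1 / 2`.
  by_cases hper : per 1 = 1
  · have hone : ∀ᵐ ω ∂μ, block K 1 ω ∈ ({fun _ => 1} : Set (Fin 1 → ℕ∞)) := by
      rw [hper] at hp1
      have hp : μ {ω | K 1 ω = ((0 + 1 : ℕ) : ℕ∞)} = 1 := by
        rw [← ENNReal.toReal_eq_one_iff]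
        simpa [measureReal_def] using hp1
      have hae : ∀ᵐ ω ∂μ, K 1 ω = ((0 + 1 : ℕ) : ℕ∞) :=
        (mem_ae_iff_prob_eq_one (hK.measurable 1 (measurableSet_singleton _))).2 hp
      filter_upwards [hae] with ω hω
      refine Set.mem_singleton_iff.2 (funext fun i => ?_)
      rw [Subsingleton.elim i 0]
      change K 1 ω = 1
      rw [hω]; simp
    refine (shannonEntropy_le_lintegral (measurable_block hK.measurable 1) hone (fun _ => 1)
      (fun _ _ => one_pos) (by simp)).trans ?_
    simp
  have hinj : Function.Injective fun x : finiteBlocks per 1 => ((x : Fin 1 → ℕ∞) 0).toNat := by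
    rintro ⟨x, s, k, _, hx⟩ ⟨y, s', k', _, hy⟩ hxy
    refine Subtype.ext (funext fun i => ?_)
    rw [Subsingleton.elim i 0]
    have hxy : (x 0).toNat = (y 0).toNat := hxy
    change x 0 = y 0
    rw [← ENat.natCast_toNat (hx 0).2, hxy, ENat.natCast_toNat (hy 0).2]
  have hH := shannonEntropy_le_lintegral (measurable_block hK.measurable 1) hmem
    (fun x => (((x 0).toNat : ℝ) * ((x 0).toNat + 1))⁻¹)
    (fun x hx => by
      have : 0 < (x 0).toNat := one_le_toNat_of_mem_finiteBlocks hx 0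
      positivity) (by
      refine (ENNReal.tsum_comp_le_tsum_of_injective hinj
        fun r : ℕ => ENNReal.ofReal ((r : ℝ) * (r + 1))⁻¹).trans ?_
      rw [ENNReal.tsum_eq_iSup_sum]
      refine iSup_le fun s => ?_
      rw [← ENNReal.ofReal_sum_of_nonneg fun r _ => by positivity]
      exact ENNReal.ofReal_le_one.2 (sum_inv_mul_add_one_le s))
  set U : Ω → ℝ := fun ω => (4 * (q * (log m - 1)) - log 2) +
    4 * (q / m) * ((K 1 ω).toNat : ℝ) ^ (1 / q) +
      2 * log 2 * Set.indicator {ω | K 1 ω = ((0 + 1 : ℕ) : ℕ∞)} 1 ω with hU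
  have hUle : ∀ᵐ ω ∂μ, 0 ≤ -log ((((block K 1 ω 0).toNat : ℝ) *
      ((block K 1 ω 0).toNat + 1))⁻¹) ∧ -log ((((block K 1 ω 0).toNat : ℝ) *
      ((block K 1 ω 0).toNat + 1))⁻¹) ≤ U ω := by
    filter_upwards [hmem] with ω hω
    have h1 := one_le_toNat_of_mem_finiteBlocks hω 0
    have hne : K 1 ω ≠ ⊤ := by obtain ⟨s, k, -, hx⟩ := hω; exact (hx 0).2
    change 1 ≤ (K 1 ω).toNat at h1
    change 0 ≤ -log ((((K 1 ω).toNat : ℝ) * ((K 1 ω).toNat + 1))⁻¹) ∧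
      -log ((((K 1 ω).toNat : ℝ) * ((K 1 ω).toNat + 1))⁻¹) ≤ U ω
    have h1' : (1 : ℝ) ≤ (K 1 ω).toNat := by exact_mod_cast h1
    rw [log_inv, neg_neg]
    refine ⟨log_nonneg (by nlinarith), ?_⟩
    have h2 := log_mul_add_one_le h1
    have h3 := log_le_of_rpow hq hm0 (x := ((K 1 ω).toNat : ℝ)) (by linarith)
    have h4 : Set.indicator {ω | K 1 ω = ((0 + 1 : ℕ) : ℕ∞)} (1 : Ω → ℝ) ω =
        if (K 1 ω).toNat = 1 then 1 else 0 := by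
      rw [Set.indicator_apply]
      refine if_congr ?_ rfl rfl
      obtain ⟨n, hn⟩ := ENat.ne_top_iff_exists.1 hne
      rw [Set.mem_ofPred_eq, ← hn, ENat.toNat_natCast, Nat.cast_inj]
    simp only [hU]
    rw [h4]
    linarith
  have hi1 : Integrable (fun ω => 4 * (q / m) * ((K 1 ω).toNat : ℝ) ^ (1 / q)) μ :=
    (hK.integral_rpow hq' h).1.const_mul _
  have hms : MeasurableSet {ω | K 1 ω = ((0 + 1 : ℕ) : ℕ∞)} :=
    hK.measurable 1 (measurableSet_singleton _)
  have hi2 : Integrable (fun ω => 2 * log 2 *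
      Set.indicator {ω | K 1 ω = ((0 + 1 : ℕ) : ℕ∞)} (1 : Ω → ℝ) ω) μ :=
    ((integrable_const (1 : ℝ)).indicator hms).const_mul _
  have hi0 : Integrable (fun ω => (4 * (q * (log m - 1)) - log 2) +
      4 * (q / m) * ((K 1 ω).toNat : ℝ) ^ (1 / q)) μ := (integrable_const _).add hi1
  have hUi : Integrable U μ := hi0.add hi2
  have hUint : ∫ ω, U ω ∂μ = (4 * (q * (log m - 1)) - log 2) + 4 * (q / m) * m +
      2 * log 2 * ((per 1 : ℕ) : ℝ)⁻¹ := by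
    simp only [hU]
    rw [integral_add hi0 hi2, integral_add (integrable_const _) hi1, integral_const_mul,
      integral_const_mul, integral_indicator_one hms, hp1, (hK.integral_rpow hq' h).2]
    simp [hm]
  calc shannonEntropy μ (block K 1) ≤ _ := hH
    _ ≤ ∫⁻ ω, ENNReal.ofReal (U ω) ∂μ := by
        refine lintegral_mono_ae ?_
        filter_upwards [hUle] with ω hω using ENNReal.ofReal_le_ofReal hω.2
    _ = ENNReal.ofReal (∫ ω, U ω ∂μ) := by
        rw [ofReal_integral_eq_lintegral_ofReal hUi]
        filter_upwards [hUle] with ω hω using hω.1.trans hω.2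
    _ ≤ _ := by
        refine ENNReal.ofReal_le_ofReal ?_
        rw [hUint, show 4 * (q / m) * m = 4 * q by field_simp]
        have h2 : (2 : ℝ) ≤ (per 1 : ℕ) := by
          have : (per 1 : ℕ) ≠ 1 := fun e => hper (PNat.eq e)
          have := (per 1).pos
          exact_mod_cast (by omega : 2 ≤ (per 1 : ℕ))
        have h3 : ((per 1 : ℕ) : ℝ)⁻¹ ≤ 2⁻¹ := inv_anti₀ two_pos h2
        nlinarith [log_pos one_lt_two]

/-- The upper bound for the block entropy in real numbers. -/
theorem IsMultiperiodicProcess.shannonEntropy_le [IsProbabilityMeasure μ]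
    (hK : IsMultiperiodicProcess μ per K) {q : ℝ} (hq : 0 < q) {t : ℕ+}
    (h : expectedPow μ (K t) (1 / q) ≠ ∞) {T : ℕ} (hT : 1 ≤ T) :
    shannonEntropy μ (block K T) ≤ ENNReal.ofReal ((exp 1 * expectedTypes μ K T + 2) *
      ((q + 2) * log T + q * log (expectedPow μ (K t) (1 / q)).toReal)) := by
  have hq' : 0 < 1 / q := by positivity
  have hE := hK.one_le_expectedTypes hq' h hT
  have hm1 : 1 ≤ (expectedPow μ (K t) (1 / q)).toReal := by
    rw [← ENNReal.toReal_one]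
    exact ENNReal.toReal_mono h (hK.one_le_expectedPow t hq')
  have hlm := mul_nonneg hq.le (log_nonneg hm1)
  have he : 2.7 ≤ exp 1 := by linarith [exp_one_gt_d9]
  have heE : 2.7 * expectedTypes μ K T ≤ exp 1 * expectedTypes μ K T :=
    mul_le_mul_of_nonneg_right he (by linarith)
  -- For `T = 1` the factor `4` is below `e E + 2`, as `E ≥ 1`. For `T ≥ 2`, `log T ≥ log 2` absorbs
  -- both additive constants.
  rcases hT.eq_or_lt with rfl | hT2
  · refine (hK.shannonEntropy_block_one_le hq h).trans (ENNReal.ofReal_le_ofReal ?_)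
    simp only [Nat.cast_one, log_one, mul_zero, zero_add]
    exact mul_le_mul_of_nonneg_right (by linarith) hlm
  · refine (hK.shannonEntropy_le_aux hq h hT).trans (ENNReal.ofReal_le_ofReal ?_)
    have hT' : (2 : ℝ) ≤ T := by exact_mod_cast hT2
    have hlT : log 2 ≤ log T := log_le_log two_pos hT'
    have hl2 := log_two_gt_d9
    rw [log_mul (by positivity) (by positivity)]
    set E := expectedTypes μ K T
    set L := log (T : ℝ)
    set M := q * log (expectedPow μ (K t) (1 / q)).toReal with hM
    have hqL : 0 ≤ q * L := mul_nonneg hq.le (by linarith)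
    have h1 : 1 + E * (L + log 2) ≤ (exp 1 * E + 2) * (2 * L) := by
      have h3 : (2.7 * E + 2) * (2 * L) ≤ (exp 1 * E + 2) * (2 * L) :=
        mul_le_mul_of_nonneg_right (by linarith) (by linarith)
      have h4 : E * (L + log 2) ≤ E * (2 * L) :=
        mul_le_mul_of_nonneg_left (by linarith) (by linarith)
      have h5 : 0 ≤ E * L := mul_nonneg (by linarith) (by linarith)
      nlinarith
    have h2 : 2 * E * (q * L + M) ≤ (exp 1 * E + 2) * (q * L + M) :=
      mul_le_mul_of_nonneg_right (by linarith) (by linarith)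
    calc _ = 1 + E * (L + log 2) + 2 * E * (q * L + M) := by rw [hM]; ring
      _ ≤ _ := add_le_add h1 h2
      _ = _ := by ring

end

/-! ### Entropy of the Santa Fe process -/

section BlockTypes

open scoped Classical in
/-- The finite types in a block. -/
noncomputable def blockTypes {T : ℕ} (x : Fin T → ℕ∞) : Finset ℕ+ :=
  (Finset.univ.filter fun t => x t ≠ ⊤).image fun t => (x t).toNat.toPNat'

theorem mem_blockTypes {T : ℕ} {x : Fin T → ℕ∞} {t : Fin T} (h : x t ≠ ⊤) :
    (x t).toNat.toPNat' ∈ blockTypes x :=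
  Finset.mem_image.2 ⟨t, by simpa using h, rfl⟩

open scoped Classical in
/-- The block of a Santa Fe process in which `x` is read off and `b` are the copied bits. -/
noncomputable def attachBits {T : ℕ} (x : Fin T → ℕ∞) (b : blockTypes x → Bool) :
    Fin T → ℕ∞ × Option Bool :=
  fun t => (x t, if h : x t = ⊤ then none else some (b ⟨_, mem_blockTypes h⟩))

/-- Each type of a block is read at some time, so its bit is visible there. -/
theorem injective_attachBits {T : ℕ} :
    Function.Injective fun p : (x : Fin T → ℕ∞) × (blockTypes x → Bool) =>
      attachBits p.1 p.2 := by
  rintro ⟨x, b⟩ ⟨y, c⟩ h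
  have hxy : x = y := funext fun t => congrArg Prod.fst (congrFun h t)
  subst hxy
  refine congrArg (Sigma.mk x) (funext fun r => ?_)
  obtain ⟨r, hr⟩ := r
  obtain ⟨t, ht, rfl⟩ := Finset.mem_image.1 hr
  have htop : x t ≠ ⊤ := by simpa using ht
  have := congrArg Prod.snd (congrFun h t)
  simpa [attachBits, htop] using this

end BlockTypes

/-- Splitting an atom of mass `p` into `2 ^ n` equal atoms adds `n` bits of entropy, weighted by
`p`. -/
theorem two_pow_mul_negMulLog {p : ℝ} (n : ℕ) (hp : 0 ≤ p) :
    (2 : ℝ) ^ n * negMulLog (p * (2⁻¹) ^ n) = negMulLog p + p * (n * log 2) := by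
  rcases hp.eq_or_lt with rfl | hp
  · simp
  · rw [negMulLog, negMulLog, log_mul hp.ne' (by positivity), log_pow, log_inv]
    have : (2 : ℝ) ^ n * (2⁻¹) ^ n = 1 := by rw [← mul_pow]; norm_num
    linear_combination (-p * (log p + n * -log 2)) * this

section

variable {Ω : Type*} [MeasurableSpace Ω] {μ : Measure Ω} {per : ℕ+ → ℕ+} {K : ℕ+ → Ω → ℕ∞}
  {Z : ℕ+ → Ω → Bool}

theorem block_santaFe (K : ℕ+ → Ω → ℕ∞) (Z : ℕ+ → Ω → Bool) (T : ℕ) (ω : Ω) :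
    block (santaFe K Z) T ω = attachBits (block K T ω) fun r => Z r ω := by
  funext t
  simp only [block, santaFe, attachBits]
  by_cases h : K (t : ℕ).succPNat ω = ⊤ <;> simp [h]

theorem coe_blockTypes {T : ℕ} {ω : Ω} (h : ∀ t, 1 ≤ K t ω) :
    (blockTypes (block K T ω) : Set ℕ+) = typeSet K T ω := by
  symm
  ext r
  simp only [typeSet, Set.mem_ofPred_eq, blockTypes, Finset.coe_image, Finset.coe_filter,
    Finset.mem_univ, true_and, Set.mem_image]
  constructor
  · rintro ⟨u, hu, hur⟩
    have hi : u.natPred < T := by have := PNat.natPred_add_one u; omega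
    have hxi : block K T ω ⟨u.natPred, hi⟩ = ((r : ℕ) : ℕ∞) := by
      simp only [block, PNat.succPNat_natPred, hur]
    exact ⟨⟨u.natPred, hi⟩, by rw [hxi]; exact ENat.natCast_ne_top _,
      by rw [hxi, ENat.toNat_natCast]; exact PNat.eq (by simp)⟩
  · rintro ⟨t, ht, rfl⟩
    refine ⟨(t : ℕ).succPNat, t.2, ?_⟩
    obtain ⟨n, hn⟩ := ENat.ne_top_iff_exists.1 ht
    have h1 : 1 ≤ block K T ω t := h _
    change block K T ω t = _
    rw [← hn] at h1 ⊢
    have : 0 < n := by exact_mod_cast h1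
    rw [ENat.toNat_natCast, Nat.toPNat'_coe, if_pos this]

theorem ncard_typeSet_eq_card_blockTypes {T : ℕ} {ω : Ω} (h : ∀ t, 1 ≤ K t ω) :
    (typeSet K T ω).ncard = (blockTypes (block K T ω)).card := by
  rw [← coe_blockTypes h, Set.ncard_coe_finset]

theorem measureReal_block_santaFe (hZ : IsFairCoinFlips μ Z) (hind : IndepFun (fun ω r => Z r ω) (fun ω t => K t ω) μ)
    {T : ℕ} (x : Fin T → ℕ∞) (b : blockTypes x → Bool) :
    μ.real {ω | block (santaFe K Z) T ω = attachBits x b} =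
      μ.real {ω | block K T ω = x} * (2⁻¹) ^ (blockTypes x).card := by
  have hset : {ω | block (santaFe K Z) T ω = attachBits x b} =
      {ω | ∀ r : blockTypes x, Z r ω = b r} ∩ {ω | block K T ω = x} := by
    ext ω
    rw [Set.mem_ofPred_eq, block_santaFe]
    constructor
    · intro h
      have hs := injective_attachBits (a₁ := ⟨block K T ω, fun r => Z r ω⟩) (a₂ := ⟨x, b⟩) h
      obtain ⟨h1, h2⟩ := Sigma.mk.inj hs
      subst h1
      exact ⟨fun r => congrFun (eq_of_heq h2) r, rfl⟩
    · rintro ⟨h1, rfl⟩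
      exact congrArg _ (funext h1)
  have hA : MeasurableSet {z : ℕ+ → Bool | ∀ r : blockTypes x, z r = b r} := by
    have : {z : ℕ+ → Bool | ∀ r : blockTypes x, z r = b r} =
        ⋂ r : blockTypes x, (fun z : ℕ+ → Bool => z r) ⁻¹' {b r} := by
      ext z; simp
    rw [this]
    exact MeasurableSet.iInter fun r => measurable_pi_apply _ (measurableSet_singleton _)
  have hB : MeasurableSet {k : ℕ+ → ℕ∞ | (fun i : Fin T => k (i : ℕ).succPNat) = x} :=
    (measurable_pi_lambda (fun (k : ℕ+ → ℕ∞) (i : Fin T) => k (i : ℕ).succPNat)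
      fun i => measurable_pi_apply _) (measurableSet_singleton x)
  have hbits : μ {ω | ∀ r : blockTypes x, Z r ω = b r} = (2⁻¹) ^ (blockTypes x).card := by
    have h := hZ.indep.measure_inter_preimage_eq_mul (blockTypes x)
      -- Quantifying over the membership proof extends the condition on `b` to all indices,
      -- vacuously outside the types.
      (sets := fun r => {c | ∀ h : r ∈ blockTypes x, c = b ⟨r, h⟩})
      fun _ _ => MeasurableSet.of_discrete
    have h2 : ∀ r ∈ blockTypes x, μ (Z r ⁻¹' {c | ∀ h : r ∈ blockTypes x, c = b ⟨r, h⟩}) = 2⁻¹ := by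
      intro r hr
      rw [← hZ.fair r (b ⟨r, hr⟩)]
      congr 1
      ext ω
      simp [hr]
    rw [Finset.prod_congr rfl h2, Finset.prod_const] at h
    rw [← h]
    congr 1
    ext ω
    simp only [Set.mem_ofPred_eq, Subtype.forall, Set.mem_iInter, Set.mem_preimage]
    exact ⟨fun h r hr _ => h r hr, fun h r hr => h r hr hr⟩
  have hmul := hind.measure_inter_preimage_eq_mul _ _ hA hB
  have h1 : (fun ω r => Z r ω) ⁻¹' {z : ℕ+ → Bool | ∀ r : blockTypes x, z r = b r} =
      {ω | ∀ r : blockTypes x, Z r ω = b r} := rfl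
  have h2 : (fun ω t => K t ω) ⁻¹' {k : ℕ+ → ℕ∞ | (fun i : Fin T => k (i : ℕ).succPNat) = x} =
      {ω | block K T ω = x} := rfl
  rw [h1, h2, hbits] at hmul
  rw [measureReal_def, hset, hmul, ENNReal.toReal_mul, mul_comm, measureReal_def]
  simp

/-- The copied bits contribute one bit per type to the block entropy of a Santa Fe process. -/
theorem IsMultiperiodicProcess.shannonEntropy_santaFe [IsProbabilityMeasure μ]
    (hK : IsMultiperiodicProcess μ per K) (hZ : IsFairCoinFlips μ Z)
    (hind : IndepFun (fun ω r => Z r ω) (fun ω t => K t ω) μ) (T : ℕ) :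
    shannonEntropy μ (block (santaFe K Z) T) =
      shannonEntropy μ (block K T) + ENNReal.ofReal (expectedTypes μ K T * log 2) := by
  -- Only blocks that arise by attaching bits have mass, so the entropy is a sum over pairs `(x,
  -- b)`.
  have hsupp : Function.support (fun y => ENNReal.ofReal (negMulLog
      (μ.real {ω | block (santaFe K Z) T ω = y}))) ⊆
        Set.range fun p : (x : Fin T → ℕ∞) × (blockTypes x → Bool) => attachBits p.1 p.2 := by
    intro y hy
    by_contra hne
    refine hy ?_
    have : {ω | block (santaFe K Z) T ω = y} = ∅ := by
      refine Set.eq_empty_of_forall_notMem fun ω hω => hne ?_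
      exact ⟨⟨block K T ω, fun r => Z r ω⟩, (block_santaFe K Z T ω).symm.trans hω⟩
    simp [this]
  have hcard : ENNReal.ofReal (expectedTypes μ K T * log 2) =
      ∑' x : Fin T → ℕ∞, ENNReal.ofReal ((blockTypes x).card * log 2) *
        μ {ω | block K T ω = x} := by
    have hbm := measurable_block hK.measurable T
    rw [← lintegral_comp_eq_tsum hbm, expectedTypes, ← integral_mul_const]
    have hae : ∀ᵐ ω ∂μ, ((typeSet K T ω).ncard : ℝ) * log 2 =
        ((blockTypes (block K T ω)).card : ℝ) * log 2 := by
      filter_upwards [hK.one_le] with ω hω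
      rw [ncard_typeSet_eq_card_blockTypes hω]
    rw [integral_congr_ae hae, ofReal_integral_eq_lintegral_ofReal]
    · refine ((hK.integrable_card T).mul_const (log 2)).congr ?_
      filter_upwards [hK.one_le] with ω hω
      rw [← ncard_typeSet_eq_card_blockTypes hω, ncard_typeSet_eq hω]
    · exact Eventually.of_forall fun ω =>
        mul_nonneg (Nat.cast_nonneg _) (log_nonneg one_le_two)
  rw [hcard, shannonEntropy, shannonEntropy, ← ENNReal.tsum_add,
    ← injective_attachBits.tsum_eq hsupp, ENNReal.tsum_sigma']
  refine tsum_congr fun x => ?_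
  have hterm : ∀ b : blockTypes x → Bool, ENNReal.ofReal (negMulLog
      (μ.real {ω | block (santaFe K Z) T ω = attachBits x b})) = ENNReal.ofReal (negMulLog
        (μ.real {ω | block K T ω = x} * (2⁻¹) ^ (blockTypes x).card)) := fun b => by
    rw [measureReal_block_santaFe hZ hind]
  have hμ : μ {ω | block K T ω = x} = ENNReal.ofReal (μ.real {ω | block K T ω = x}) := by simp
  simp only [hterm]
  rw [tsum_fintype, Finset.sum_const, Finset.card_univ, Fintype.card_fun, Fintype.card_bool,
    Fintype.card_coe, hμ, mul_comm (ENNReal.ofReal (_ * log 2)), ← ENNReal.ofReal_mul measureReal_nonneg,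
    ← ENNReal.ofReal_add (negMulLog_nonneg measureReal_nonneg measureReal_le_one)
      (mul_nonneg measureReal_nonneg (mul_nonneg (Nat.cast_nonneg _) (log_nonneg one_le_two))),
    ← two_pow_mul_negMulLog _ measureReal_nonneg, ENNReal.ofReal_mul (by positivity), nsmul_eq_mul]
  simp

end

/-! ### Power laws for linear periods -/

theorem one_sub_inv_le_rpow {c x : ℝ} (hc : 0 < c) (hx : 0 < x) :
    1 - (c * x)⁻¹ ≤ (x / (x + 1)) ^ (1 / c) := by
  have h1 : -x⁻¹ ≤ log (x / (x + 1)) := by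
    have := one_sub_inv_le_log_of_pos (div_pos hx (by linarith : 0 < x + 1))
    have h2 : 1 - (x / (x + 1))⁻¹ = -x⁻¹ := by field_simp; ring
    linarith
  rw [rpow_def_of_pos (by positivity)]
  calc 1 - (c * x)⁻¹ = -x⁻¹ * (1 / c) + 1 := by field_simp; ring
    _ ≤ log (x / (x + 1)) * (1 / c) + 1 := by gcongr
    _ ≤ _ := add_one_le_exp _

section

variable {per : ℕ+ → ℕ+} {c : ℝ}

theorem tailProb_succ (per : ℕ+ → ℕ+) (n : ℕ) :
    tailProb per (n + 1) = tailProb per n * (1 - ((per n.succPNat : ℕ) : ℝ)⁻¹) :=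
  Finset.prod_range_succ _ _

theorem one_sub_inv_per_nonneg (per : ℕ+ → ℕ+) (r : ℕ+) : 0 ≤ 1 - ((per r : ℕ) : ℝ)⁻¹ :=
  sub_nonneg.2 (inv_le_one_of_one_le₀ (by exact_mod_cast one_le (a := per r)))

theorem tailProb_nonneg (per : ℕ+ → ℕ+) (n : ℕ) : 0 ≤ tailProb per n :=
  Finset.prod_nonneg fun _ _ => one_sub_inv_per_nonneg per _

theorem per_bounds (hc : 0 < c) (hper : ∀ r : ℕ+, (per r : ℕ) = 1 + ⌈c * ((r : ℕ) : ℝ)⌉₊)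
    (n : ℕ) : 1 + c * (n + 1) ≤ ((per n.succPNat : ℕ) : ℝ) ∧
      ((per n.succPNat : ℕ) : ℝ) ≤ 2 + c * (n + 1) := by
  rw [hper]
  have h1 := Nat.le_ceil (c * ((n.succPNat : ℕ) : ℝ))
  have h2 := Nat.ceil_lt_add_one (a := c * ((n.succPNat : ℕ) : ℝ)) (by positivity)
  push_cast
  simp only [Nat.succPNat_coe, Nat.succ_eq_add_one, Nat.cast_add, Nat.cast_one] at h1 h2 ⊢
  constructor <;> linarith

theorem tailProb_le (hc : 0 < c) (hper : ∀ r : ℕ+, (per r : ℕ) = 1 + ⌈c * ((r : ℕ) : ℝ)⌉₊)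
    (n : ℕ) : tailProb per n ≤ (1 + 2 / c) ^ (1 / c) * ((n : ℝ) + 1) ^ (-(1 / c)) := by
  -- Since `per ≤ c (n + 1 + 2 / c)`, the shift `2 / c` makes the factors of `one_sub_inv_le_rpow`
  -- telescope.
  have key : tailProb per n ≤ ((1 + 2 / c) / (n + 1 + 2 / c)) ^ (1 / c) := by
    induction n with
    | zero =>
      have : (1 + 2 / c) / (((0 : ℕ) : ℝ) + 1 + 2 / c) = 1 := by
        rw [Nat.cast_zero, zero_add, div_self (by positivity)]
      rw [this, one_rpow]
      simp [tailProb]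
    | succ n ih =>
      have hx : 0 < (n : ℝ) + 1 + 2 / c := by positivity
      have hp := (per_bounds hc hper n).2
      have h0 := (per_bounds hc hper n).1
      have hfac : 1 - ((per n.succPNat : ℕ) : ℝ)⁻¹ ≤
          ((n + 1 + 2 / c) / (n + 1 + 2 / c + 1)) ^ (1 / c) := by
        refine le_trans ?_ (one_sub_inv_le_rpow hc hx)
        refine sub_le_sub_left (inv_anti₀ ?_ ?_) _
        · exact lt_of_lt_of_le (by positivity) h0
        · refine hp.trans (le_of_eq ?_)
          field_simp
          ring
      rw [tailProb_succ]
      calc _ ≤ ((1 + 2 / c) / (n + 1 + 2 / c)) ^ (1 / c) *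
            ((n + 1 + 2 / c) / (n + 1 + 2 / c + 1)) ^ (1 / c) :=
            mul_le_mul ih hfac (one_sub_inv_per_nonneg _ _) (by positivity)
        _ = _ := by
            rw [← mul_rpow (by positivity) (by positivity), div_mul_div_cancel₀ hx.ne']
            congr 2
            push_cast
            ring
  refine key.trans ?_
  rw [rpow_neg (by positivity), ← div_eq_mul_inv, ← div_rpow (by positivity) (by positivity)]
  refine rpow_le_rpow (by positivity) ?_ (by positivity)
  have : 0 < 2 / c := by positivity
  exact div_le_div_of_nonneg_left (by positivity) (by positivity) (by linarith)

theorem le_tailProb (hc : 0 < c) (hper : ∀ r : ℕ+, (per r : ℕ) = 1 + ⌈c * ((r : ℕ) : ℝ)⌉₊)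
    (n : ℕ) : exp (-(1 / c)) * ((n : ℝ) + 1) ^ (-(1 / c)) ≤ tailProb per n := by
  have hfac : ∀ m : ℕ, exp (-(1 / (c * (m + 1)))) ≤ 1 - ((per m.succPNat : ℕ) : ℝ)⁻¹ := by
    intro m
    have h1 : 1 - (1 + c * ((m : ℝ) + 1))⁻¹ ≤ 1 - ((per m.succPNat : ℕ) : ℝ)⁻¹ :=
      sub_le_sub_left (inv_anti₀ (by positivity) (per_bounds hc hper m).1) _
    refine le_trans ?_ h1
    have h2 : 1 - (1 + c * ((m : ℝ) + 1))⁻¹ = (1 / (c * (m + 1)) + 1)⁻¹ := by field_simp; ring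
    rw [h2, exp_neg]
    exact inv_anti₀ (by positivity) (add_one_le_exp _)
  -- The first factor gives `exp (-(1 / c))`; the later ones dominate `((m + 1) / (m + 2)) ^ (1 /
  -- c)`, which telescopes.
  have key : ∀ m : ℕ, exp (-(1 / c)) * ((m : ℝ) + 1) ^ (-(1 / c)) ≤ tailProb per (m + 1) := by
    intro m
    induction m with
    | zero =>
      have := hfac 0
      simpa [tailProb] using this
    | succ m ih =>
      rw [tailProb_succ]
      refine le_trans ?_ (mul_le_mul ih (hfac (m + 1)) (exp_pos _).le (tailProb_nonneg _ _))
      rw [mul_assoc]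
      refine mul_le_mul_of_nonneg_left ?_ (exp_pos _).le
      have h3 : ((m : ℝ) + 1) / (m + 2) ≤ exp (-(1 / ((m : ℝ) + 2))) := by
        have := add_one_le_exp (-(1 / ((m : ℝ) + 2)))
        refine le_trans (le_of_eq ?_) this
        field_simp
        ring
      have h4 : (((m : ℝ) + 1) / (m + 2)) ^ (1 / c) ≤ exp (-(1 / (c * (((m + 1 : ℕ) : ℝ) + 1)))) := by
        refine (rpow_le_rpow (by positivity) h3 (by positivity)).trans (le_of_eq ?_)
        rw [← exp_mul]
        congr 1
        push_cast
        field_simp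
        ring
      calc (((m + 1 : ℕ) : ℝ) + 1) ^ (-(1 / c))
          = ((m : ℝ) + 1) ^ (-(1 / c)) * (((m : ℝ) + 1) / (m + 2)) ^ (1 / c) := by
            rw [div_rpow (by positivity) (by positivity), rpow_neg (by positivity),
              rpow_neg (by positivity)]
            have : ((m : ℝ) + 1) ^ (1 / c) ≠ 0 := (rpow_pos_of_pos (by positivity) _).ne'
            rw [show ((m + 1 : ℕ) : ℝ) + 1 = m + 2 by push_cast; ring]
            field_simp
        _ ≤ _ := mul_le_mul_of_nonneg_left h4 (by positivity)
  cases n with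
  | zero => simpa [tailProb] using hc.le
  | succ n =>
    refine le_trans (mul_le_mul_of_nonneg_left ?_ (exp_pos _).le) (key n)
    refine rpow_le_rpow_of_nonpos (by positivity) ?_ (by simpa using hc.le)
    push_cast
    linarith

/-- Each of the `n` deletions costs at most one token beyond its expected share, and later factors
only shrink earlier errors. -/
theorem IsMultiperiodicSeq.le_decimatedPos {s : ℕ+ → ℕ} {k : ℕ+ → ℕ∞}
    (h : IsMultiperiodicSeq per s k) (T : ℕ+) (n : ℕ) :
    tailProb per n * (T : ℕ) - n ≤ decimatedPos k n.succPNat T := by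
  induction n with
  | zero =>
    have := h.decimatedPos_one T
    rw [show Nat.succPNat 0 = 1 from rfl, this]
    simp [tailProb]
  | succ n ih =>
    have h1 := h.decimatedPos_add_one_ge n.succPNat T
    rw [show n.succPNat + 1 = (n + 1).succPNat from rfl] at h1
    refine le_trans ?_ h1
    have h2 := mul_le_mul_of_nonneg_right ih (one_sub_inv_per_nonneg per n.succPNat)
    have h3 : (n : ℝ) * (1 - ((per n.succPNat : ℕ) : ℝ)⁻¹) ≤ n :=
      mul_le_of_le_one_right (Nat.cast_nonneg _) (sub_le_self _ (by positivity))
    rw [tailProb_succ]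
    push_cast
    nlinarith

/-- All types up to a multiple of `T ^ (c / (c + 1))` occur in a block of length `T`. -/
theorem IsMultiperiodicSeq.exists_eq_of_le {s : ℕ+ → ℕ} {k : ℕ+ → ℕ∞}
    (h : IsMultiperiodicSeq per s k) (hc : 0 < c)
    (hper : ∀ r : ℕ+, (per r : ℕ) = 1 + ⌈c * ((r : ℕ) : ℝ)⌉₊) (T : ℕ+) (n : ℕ)
    (hn : (n : ℝ) + 1 ≤ (exp (-(1 / c)) * (T : ℕ) / (c + 3)) ^ (c / (c + 1))) :
    ∃ t ≤ T, k t = ((n.succPNat : ℕ) : ℕ∞) := by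
  refine h.exists_eq n.succPNat T ?_
  have h1 := h.le_decimatedPos T n
  have h2 := le_tailProb hc hper n
  have hn1 : (0 : ℝ) < (n : ℝ) + 1 := by positivity
  have hT : (0 : ℝ) < (T : ℕ) := by exact_mod_cast T.pos
  have h3 : ((n : ℝ) + 1) ^ ((c + 1) / c) ≤ exp (-(1 / c)) * (T : ℕ) / (c + 3) := by
    have := rpow_le_rpow hn1.le hn (z := (c + 1) / c) (by positivity)
    rwa [← rpow_mul (by positivity), show c / (c + 1) * ((c + 1) / c) = 1 by field_simp,
      rpow_one] at this
  have h4 : ((n : ℝ) + 1) ^ ((c + 1) / c) = (n + 1) * ((n : ℝ) + 1) ^ (1 / c) := by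
    rw [show (c + 1) / c = 1 + 1 / c by field_simp, rpow_add hn1, rpow_one]
  rw [h4, le_div_iff₀ (by positivity)] at h3
  have h5 : ((n : ℝ) + 1) * (c + 3) ≤ tailProb per n * (T : ℕ) := by
    refine le_trans ?_ (mul_le_mul_of_nonneg_right h2 hT.le)
    have h6 : ((n : ℝ) + 1) ^ (1 / c) * ((n : ℝ) + 1) ^ (-(1 / c)) = 1 := by
      rw [← rpow_add hn1, add_neg_cancel, rpow_zero]
    have h7 := mul_le_mul_of_nonneg_right h3 (rpow_nonneg hn1.le (-(1 / c)))
    calc ((n : ℝ) + 1) * (c + 3) =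
          (n + 1) * (c + 3) * (((n : ℝ) + 1) ^ (1 / c) * ((n : ℝ) + 1) ^ (-(1 / c))) := by
            rw [h6, mul_one]
      _ = (n + 1) * ((n : ℝ) + 1) ^ (1 / c) * (c + 3) * ((n : ℝ) + 1) ^ (-(1 / c)) := by ring
      _ ≤ _ := h7
      _ = _ := by ring
  have h8 := (per_bounds hc hper n).2
  -- The constant `c + 3` leaves room for the period, at most `2 + c (n + 1)`, and for the error
  -- `n`.
  have h9 : ((per n.succPNat : ℕ) : ℝ) ≤ decimatedPos k n.succPNat T := by nlinarith
  exact_mod_cast h9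

variable {Ω : Type*} [MeasurableSpace Ω] {μ : Measure Ω} {K : ℕ+ → Ω → ℕ∞}

/-- There are at most `R` types up to `R`, and at most as many larger ones as tokens exceeding `R`.
-/
theorem IsMultiperiodicProcess.expectedTypes_le [IsProbabilityMeasure μ]
    (hK : IsMultiperiodicProcess μ per K) (T R : ℕ) :
    expectedTypes μ K T ≤ R + T * tailProb per R := by
  have hms : ∀ t, MeasurableSet {ω | ((R + 1 : ℕ) : ℕ∞) ≤ K t ω} := fun t =>
    hK.measurable t (MeasurableSet.of_discrete (s := {x | ((R + 1 : ℕ) : ℕ∞) ≤ x}))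
  have hi : ∀ t, Integrable (Set.indicator {ω | ((R + 1 : ℕ) : ℕ∞) ≤ K t ω} (1 : Ω → ℝ)) μ :=
    fun t => (integrable_const (1 : ℝ)).indicator (hms t)
  have hint : ∫ ω, ((R : ℝ) + ∑ i : Fin T, Set.indicator
      {ω | ((R + 1 : ℕ) : ℕ∞) ≤ K (i : ℕ).succPNat ω} (1 : Ω → ℝ) ω) ∂μ =
        R + T * tailProb per R := by
    rw [integral_add (integrable_const _) (integrable_finsetSum _ fun i _ => hi _),
      integral_finsetSum _ fun i _ => hi _]
    simp only [integral_indicator_one (hms _), hK.measureReal_add_one_le]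
    simp
  rw [← hint, hK.expectedTypes_eq]
  refine integral_mono_ae (hK.integrable_card T)
    ((integrable_const _).add (integrable_finsetSum _ fun i _ => hi _)) ?_
  filter_upwards [hK.one_le] with ω hω
  classical
  have h1 : ((firstTimes (block K T ω)).filter
      fun t => ¬ ((R + 1 : ℕ) : ℕ∞) ≤ block K T ω t).card ≤ R := by
    refine (Finset.card_le_card_of_injOn (t := Finset.Icc 1 R)
      (fun t => (block K T ω t).toNat) ?_ ?_).trans (by simp)
    · intro t ht
      rw [Finset.coe_filter] at ht
      obtain ⟨h1, h2⟩ := ht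
      obtain ⟨n, hn⟩ := ENat.ne_top_iff_exists.1 (mem_firstTimes.1 h1).1
      have h3 : 1 ≤ block K T ω t := hω _
      simp only
      rw [← hn] at h2 h3 ⊢
      have h2' : ¬ R + 1 ≤ n := by exact_mod_cast h2
      have h3' : 1 ≤ n := by exact_mod_cast h3
      rw [ENat.toNat_natCast, Finset.mem_coe, Finset.mem_Icc]
      omega
    · intro t ht u hu e
      rw [Finset.coe_filter] at ht hu
      refine injOn_firstTimes _ ht.1 hu.1 ?_
      simp only at e
      rw [← ENat.natCast_toNat (mem_firstTimes.1 ht.1).1, e,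
        ENat.natCast_toNat (mem_firstTimes.1 hu.1).1]
  have h2 : ((firstTimes (block K T ω)).filter
      fun t => ((R + 1 : ℕ) : ℕ∞) ≤ block K T ω t).card ≤
        (Finset.univ.filter fun t : Fin T => ((R + 1 : ℕ) : ℕ∞) ≤ block K T ω t).card :=
    Finset.card_le_card (Finset.filter_subset_filter _ (Finset.subset_univ _))
  have h3 : ((Finset.univ.filter fun t : Fin T =>
      ((R + 1 : ℕ) : ℕ∞) ≤ block K T ω t).card : ℝ) = ∑ i : Fin T, Set.indicator
        {ω | ((R + 1 : ℕ) : ℕ∞) ≤ K (i : ℕ).succPNat ω} (1 : Ω → ℝ) ω := by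
    rw [Finset.card_filter]
    push_cast
    exact Finset.sum_congr rfl fun i _ => by rw [Set.indicator_apply]; rfl
  have h4 := Finset.card_filter_add_card_filter_not (s := firstTimes (block K T ω))
    fun t => ((R + 1 : ℕ) : ℕ∞) ≤ block K T ω t
  rw [← h3]
  exact_mod_cast (by omega : (firstTimes (block K T ω)).card ≤ R + _)

theorem IsMultiperiodicProcess.expectedTypes_le_rpow [IsProbabilityMeasure μ]
    (hK : IsMultiperiodicProcess μ per K) (hc : 0 < c)
    (hper : ∀ r : ℕ+, (per r : ℕ) = 1 + ⌈c * ((r : ℕ) : ℝ)⌉₊) {T : ℕ} (hT : 1 ≤ T) :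
    expectedTypes μ K T ≤ (1 + (1 + 2 / c) ^ (1 / c)) * (T : ℝ) ^ (c / (c + 1)) := by
  have hT0 : (0 : ℝ) < T := by exact_mod_cast hT
  have hpos : 0 < (T : ℝ) ^ (c / (c + 1)) := rpow_pos_of_pos hT0 _
  have h1 := hK.expectedTypes_le T ⌊(T : ℝ) ^ (c / (c + 1))⌋₊
  have h2 := Nat.floor_le hpos.le
  have h3 : (T : ℝ) ^ (c / (c + 1)) ≤ (⌊(T : ℝ) ^ (c / (c + 1))⌋₊ : ℝ) + 1 :=
    (Nat.lt_floor_add_one _).le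
  have h4 := tailProb_le hc hper ⌊(T : ℝ) ^ (c / (c + 1))⌋₊
  have h5 : ((⌊(T : ℝ) ^ (c / (c + 1))⌋₊ : ℝ) + 1) ^ (-(1 / c)) ≤
      ((T : ℝ) ^ (c / (c + 1))) ^ (-(1 / c)) :=
    rpow_le_rpow_of_nonpos hpos h3 (by simpa using hc.le)
  -- The cut-off `R = T ^ β` balances both contributions, because `1 - β / c = β`.
  have h6 : (T : ℝ) * ((T : ℝ) ^ (c / (c + 1))) ^ (-(1 / c)) = (T : ℝ) ^ (c / (c + 1)) := by
    rw [← rpow_mul hT0.le]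
    nth_rewrite 1 [← rpow_one (T : ℝ)]
    rw [← rpow_add hT0]
    congr 1
    field_simp
    ring
  calc expectedTypes μ K T ≤ _ := h1
    _ ≤ (T : ℝ) ^ (c / (c + 1)) + T * ((1 + 2 / c) ^ (1 / c) *
          ((T : ℝ) ^ (c / (c + 1))) ^ (-(1 / c))) := by
        gcongr
        exact h4.trans (by gcongr)
    _ = (T : ℝ) ^ (c / (c + 1)) + (1 + 2 / c) ^ (1 / c) *
          (T * ((T : ℝ) ^ (c / (c + 1))) ^ (-(1 / c))) := by ring
    _ = _ := by rw [h6]; ring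

theorem IsMultiperiodicProcess.rpow_le_expectedTypes [IsProbabilityMeasure μ]
    (hK : IsMultiperiodicProcess μ per K) (hc : 0 < c)
    (hper : ∀ r : ℕ+, (per r : ℕ) = 1 + ⌈c * ((r : ℕ) : ℝ)⌉₊) {T : ℕ} (hT : 1 ≤ T) :
    (exp (-(1 / c)) / (c + 3)) ^ (c / (c + 1)) * (T : ℝ) ^ (c / (c + 1)) - 1 ≤
      expectedTypes μ K T := by
  set R := ⌊(exp (-(1 / c)) * T / (c + 3)) ^ (c / (c + 1))⌋₊ with hR
  have hR1 : (exp (-(1 / c)) / (c + 3)) ^ (c / (c + 1)) * (T : ℝ) ^ (c / (c + 1)) - 1 ≤ R := by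
    have := Nat.lt_floor_add_one ((exp (-(1 / c)) * T / (c + 3)) ^ (c / (c + 1)))
    rw [← mul_rpow (by positivity) (by positivity), div_mul_eq_mul_div]
    linarith
  refine hR1.trans ?_
  have h1 : ∫ _ : Ω, (R : ℝ) ∂μ = R := by simp
  rw [← h1, hK.expectedTypes_eq]
  refine integral_mono_ae (integrable_const _) (hK.integrable_card T) ?_
  obtain ⟨s, -, -, -, hs⟩ := hK.exists_seeds
  filter_upwards [hs] with ω hω
  rw [← ncard_typeSet_eq hω.one_le, ncard_typeSet_eq_card_blockTypes hω.one_le]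
  have hsub : (Finset.range R).image Nat.succPNat ⊆ blockTypes (block K T ω) := by
    intro r hr
    obtain ⟨n, hn, rfl⟩ := Finset.mem_image.1 hr
    rw [Finset.mem_range] at hn
    rw [← Finset.mem_coe, coe_blockTypes hω.one_le]
    have hn' : (n : ℝ) + 1 ≤ R := by exact_mod_cast hn
    obtain ⟨t, ht, e⟩ := hω.exists_eq_of_le hc hper ⟨T, hT⟩ n
      (hn'.trans (Nat.floor_le (by positivity)))
    exact ⟨t, ht, e⟩
  have := Finset.card_le_card hsub
  rw [Finset.card_image_of_injective _ Nat.succPNat_injective, Finset.card_range] at this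
  exact_mod_cast this

/-- The point masses are of order at most `n ^ (-1 - 1 / c)`. Half the tail exponent leaves the
summable `n ^ (-1 - 1 / (2 c))`. -/
theorem IsMultiperiodicProcess.expectedPow_ne_top [IsProbabilityMeasure μ]
    (hK : IsMultiperiodicProcess μ per K) (hc : 0 < c)
    (hper : ∀ r : ℕ+, (per r : ℕ) = 1 + ⌈c * ((r : ℕ) : ℝ)⌉₊) (t : ℕ+) :
    expectedPow μ (K t) (1 / (2 * c)) ≠ ∞ := by
  set C : ℝ := (1 + 2 / c) ^ (1 / c) with hC
  have htop : μ {ω | K t ω = ⊤} = 0 := by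
    have hle : ∀ n : ℕ, μ.real {ω | K t ω = ⊤} ≤ C * ((n : ℝ) + 1) ^ (-(1 / c)) := by
      intro n
      refine le_trans ?_ (tailProb_le hc hper n)
      rw [← hK.measureReal_add_one_le t n]
      refine measureReal_mono fun ω (hω : K t ω = ⊤) => ?_
      rw [Set.mem_ofPred_eq, hω]
      exact le_top
    have hlim : Tendsto (fun n : ℕ => C * ((n : ℝ) + 1) ^ (-(1 / c))) atTop (𝓝 (C * 0)) :=
      ((tendsto_rpow_neg_atTop (by positivity)).comp
        (tendsto_atTop_add_const_right _ 1 tendsto_natCast_atTop_atTop)).const_mul C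
    rw [mul_zero] at hlim
    have := le_antisymm (ge_of_tendsto' hlim hle) measureReal_nonneg
    exact (measureReal_eq_zero_iff).1 this
  have hsum : expectedPow μ (K t) (1 / (2 * c)) =
      ∑' n : ℕ, ((n : ℕ∞) : ℝ≥0∞) ^ (1 / (2 * c)) * μ {ω | K t ω = (n : ℕ∞)} := by
    rw [expectedPow, lintegral_comp_eq_tsum (hK.measurable t)
      (fun x : ℕ∞ => (x : ℝ≥0∞) ^ (1 / (2 * c)))]
    symm
    refine Function.Injective.tsum_eq (g := fun n : ℕ => (n : ℕ∞)) Nat.cast_injective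
      (f := fun x : ℕ∞ => (x : ℝ≥0∞) ^ (1 / (2 * c)) * μ {ω | K t ω = x}) ?_
    intro x hx
    induction x using ENat.recTopCoe with
    | top => exact absurd (by simp [htop]) hx
    | coe n => exact ⟨n, rfl⟩
  have hterm : ∀ n : ℕ, ((n : ℕ∞) : ℝ≥0∞) ^ (1 / (2 * c)) * μ {ω | K t ω = (n : ℕ∞)} ≤
      ENNReal.ofReal (C / c * (n : ℝ) ^ (-(1 + 1 / (2 * c)))) := by
    intro n
    cases n with
    | zero => rw [Nat.cast_zero, ENat.toENNReal_zero, ENNReal.zero_rpow_of_pos (by positivity), zero_mul]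
              exact zero_le
    | succ n =>
      have hn : (0 : ℝ) < (n : ℝ) + 1 := by positivity
      have h1 : μ {ω | K t ω = ((n + 1 : ℕ) : ℕ∞)} =
          ENNReal.ofReal (μ.real {ω | K t ω = ((n + 1 : ℕ) : ℕ∞)}) := by simp
      have h2 : (((n + 1 : ℕ) : ℕ∞) : ℝ≥0∞) = ENNReal.ofReal ((n : ℝ) + 1) := by
        rw [← Nat.cast_add_one, ENNReal.ofReal_natCast]
        simp
      rw [h1, h2, ENNReal.ofReal_rpow_of_pos hn, ← ENNReal.ofReal_mul (by positivity)]
      refine ENNReal.ofReal_le_ofReal ?_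
      have hb : ((per n.succPNat : ℕ) : ℝ)⁻¹ ≤ (c * ((n : ℝ) + 1))⁻¹ :=
        inv_anti₀ (by positivity) (by linarith [(per_bounds hc hper n).1])
      rw [hK.measureReal_eq]
      calc ((n : ℝ) + 1) ^ (1 / (2 * c)) * (tailProb per n * ((per n.succPNat : ℕ) : ℝ)⁻¹)
          ≤ ((n : ℝ) + 1) ^ (1 / (2 * c)) *
              (C * ((n : ℝ) + 1) ^ (-(1 / c)) * (c * ((n : ℝ) + 1))⁻¹) := by
            gcongr
            exact tailProb_le hc hper n
        _ = C / c * (((n : ℝ) + 1) ^ (1 / (2 * c)) * ((n : ℝ) + 1) ^ (-(1 / c)) *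
              ((n : ℝ) + 1) ^ (-1 : ℝ)) := by
            rw [rpow_neg_one, mul_inv]; ring
        _ = C / c * ((n + 1 : ℕ) : ℝ) ^ (-(1 + 1 / (2 * c))) := by
            rw [← rpow_add hn, ← rpow_add hn]
            push_cast
            congr 2
            field_simp
            ring
  rw [hsum]
  refine ne_top_of_le_ne_top ?_ (ENNReal.tsum_le_tsum hterm)
  refine Summable.tsum_ofReal_ne_top ?_
  refine Summable.mul_left _ (Real.summable_nat_rpow.2 ?_)
  have : 0 < 1 / (2 * c) := by positivity
  linarith

end

/-! ### Logarithmic asymptotics and assembly -/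

/-- Constants and a factor `log T` are invisible at this scale, since `log log T = o(log T)`. -/
theorem tendsto_log_div_log_of_le {f : ℕ → ℝ} {b A B : ℝ} (hA : 0 < A) (hB : 0 < B)
    (hl : ∀ᶠ T : ℕ in atTop, A * (T : ℝ) ^ b ≤ f T)
    (hu : ∀ᶠ T : ℕ in atTop, f T ≤ B * (T : ℝ) ^ b * log T) :
    Tendsto (fun T : ℕ => log (f T) / log T) atTop (𝓝 b) := by
  have hlog : Tendsto (fun T : ℕ => log (T : ℝ)) atTop atTop :=
    tendsto_log_atTop.comp tendsto_natCast_atTop_atTop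
  have hloglog : Tendsto (fun T : ℕ => log (log (T : ℝ)) / log T) atTop (𝓝 0) :=
    isLittleO_log_id_atTop.tendsto_div_nhds_zero.comp hlog
  have hconst : ∀ C : ℝ, Tendsto (fun T : ℕ => C / log (T : ℝ)) atTop (𝓝 0) :=
    fun C => hlog.const_div_atTop C
  have hlow : Tendsto (fun T : ℕ => log A / log (T : ℝ) + b) atTop (𝓝 b) := by
    simpa using (hconst (log A)).add_const b
  have hupp : Tendsto (fun T : ℕ => log B / log (T : ℝ) + b + log (log (T : ℝ)) / log T)
      atTop (𝓝 b) := by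
    simpa using ((hconst (log B)).add_const b).add hloglog
  refine tendsto_of_tendsto_of_tendsto_of_le_of_le' hlow hupp ?_ ?_
  · filter_upwards [hl, eventually_gt_atTop 1] with T h1 hT
    have hT1 : (1 : ℝ) < T := by exact_mod_cast hT
    have hT0 : (0 : ℝ) < T := by linarith
    have hpos := log_pos hT1
    rw [le_div_iff₀ hpos, add_mul, div_mul_cancel₀ _ hpos.ne', ← log_rpow hT0,
      ← log_mul hA.ne' (rpow_pos_of_pos hT0 b).ne']
    exact log_le_log (by positivity) h1
  · filter_upwards [hl, hu, eventually_gt_atTop 1] with T h1 h2 hT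
    have hT1 : (1 : ℝ) < T := by exact_mod_cast hT
    have hT0 : (0 : ℝ) < T := by linarith
    have hpos := log_pos hT1
    have hTb := rpow_pos_of_pos hT0 b
    rw [div_le_iff₀ hpos, add_mul, add_mul, div_mul_cancel₀ _ hpos.ne', div_mul_cancel₀ _ hpos.ne',
      ← log_rpow hT0, ← log_mul hB.ne' hTb.ne', ← log_mul (by positivity) hpos.ne']
    exact log_le_log (lt_of_lt_of_le (by positivity) h1) h2

theorem tendsto_log_div_rpow {f : ℕ → ℝ} {b : ℝ}
    (hf : ∀ᶠ T in atTop, 0 < f T) (h : Tendsto (fun T : ℕ => log (f T) / log T) atTop (𝓝 b)) :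
    Tendsto (fun T : ℕ => log (f T / T) / log T) atTop (𝓝 (b - 1)) := by
  refine (h.sub_const 1).congr' ?_
  filter_upwards [hf, eventually_gt_atTop 1] with T h1 hT
  have hT1 : (1 : ℝ) < T := by exact_mod_cast hT
  rw [log_div h1.ne' (by linarith), sub_div, div_self (log_pos hT1).ne']

theorem samePowerLaw_rpow {f : ℕ → ℝ} {b : ℝ} (hb : b ≠ 0)
    (h : Tendsto (fun T : ℕ => log (f T) / log T) atTop (𝓝 b)) :
    SamePowerLaw f fun T => (T : ℝ) ^ b := by
  have h1 : Tendsto (fun T : ℕ => log (f T) / log T / b) atTop (𝓝 (b / b)) := h.div_const b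
  rw [div_self hb] at h1
  refine h1.congr' ?_
  filter_upwards [eventually_gt_atTop 0] with T hT
  rw [log_rpow (by exact_mod_cast hT), div_div, mul_comm b]

theorem coe_ennreal_le_of_le_ofReal {H : ℝ≥0∞} {B : ℝ} (hB : 0 ≤ B) (h : H ≤ ENNReal.ofReal B) :
    (H : EReal) ≤ (B : EReal) := by
  have h1 : (H : EReal) ≤ ((ENNReal.ofReal B : ℝ≥0∞) : EReal) := by exact_mod_cast h
  rwa [EReal.coe_ennreal_ofReal, max_eq_left hB] at h1

theorem ENNReal.log_eq_coe_log_toReal {x : ℝ≥0∞} (h0 : x ≠ 0) (h : x ≠ ∞) :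
    ENNReal.log x = ((Real.log x.toReal : ℝ) : EReal) := by
  rw [← ENNReal.log_ofReal_of_pos (ENNReal.toReal_pos h0 h), ENNReal.ofReal_toReal h]

section

variable {Ω : Type*} [MeasurableSpace Ω] {μ : Measure Ω} {per : ℕ+ → ℕ+} {K : ℕ+ → Ω → ℕ∞}

theorem expectedTypes_nonneg (μ : Measure Ω) (K : ℕ+ → Ω → ℕ∞) (T : ℕ) :
    0 ≤ expectedTypes μ K T :=
  integral_nonneg fun _ => Nat.cast_nonneg _

theorem shannonEntropy_block_zero_ne_top {α : Type*} (μ : Measure Ω) (X : ℕ+ → Ω → α) :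
    shannonEntropy μ (block X 0) ≠ ∞ := by
  rw [shannonEntropy, tsum_fintype]
  exact ENNReal.sum_ne_top.2 fun _ _ => ENNReal.ofReal_ne_top

theorem IsMultiperiodicProcess.bound_nonneg [IsProbabilityMeasure μ]
    (hK : IsMultiperiodicProcess μ per K) {q : ℝ} (hq : 0 < q) {t : ℕ+}
    (h : expectedPow μ (K t) (1 / q) ≠ ∞) {T : ℕ} (hT : 1 ≤ T) :
    0 ≤ (exp 1 * expectedTypes μ K T + 2) *
      ((q + 2) * log T + q * log (expectedPow μ (K t) (1 / q)).toReal) := by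
  have hE := expectedTypes_nonneg μ K T
  have hT' : 0 ≤ log (T : ℝ) := log_nonneg (by exact_mod_cast hT)
  have hm1 : 0 ≤ log (expectedPow μ (K t) (1 / q)).toReal := by
    refine log_nonneg ?_
    rw [← ENNReal.toReal_one]
    exact ENNReal.toReal_mono h (hK.one_le_expectedPow t (one_div_pos.2 hq))
  positivity

end

theorem mainTheorem5 {Ω : Type*} [MeasurableSpace Ω] (μ : Measure Ω) [IsProbabilityMeasure μ]
    (per : ℕ+ → ℕ+) (K : ℕ+ → Ω → ℕ∞) (hK : IsMultiperiodicProcess μ per K) :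
    (∀ q : ℝ, 0 < q → ∀ T : ℕ, 1 ≤ T → ∀ t : ℕ+,
      (shannonEntropy μ (block K T) : EReal) ≤
        ((exp 1 * expectedTypes μ K T + 2 : ℝ) : EReal) *
          ((((q + 2) * log T : ℝ) : EReal) +
            (q : EReal) * ENNReal.log (expectedPow μ (K t) (1 / q)))) ∧
    ∀ Z : ℕ+ → Ω → Bool, IsFairCoinFlips μ Z →
      IndepFun (fun ω r => Z r ω) (fun ω t => K t ω) μ →
      (∀ T : ℕ, 1 ≤ T →
        ((expectedTypes μ K T * log 2 : ℝ) : EReal) ≤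
          (shannonEntropy μ (block (santaFe K Z) T) : EReal)) ∧
      (∀ q : ℝ, 0 < q → ∀ T : ℕ, 1 ≤ T → ∀ t : ℕ+,
        (shannonEntropy μ (block (santaFe K Z) T) : EReal) ≤
          ((exp 1 * expectedTypes μ K T + 2 : ℝ) : EReal) *
            ((((q + 2) * log T : ℝ) : EReal) +
              (q : EReal) * ENNReal.log (expectedPow μ (K t) (1 / q)) +
              ((log 2 / exp 1 : ℝ) : EReal))) ∧
      (∀ c : ℝ, 0 < c → (∀ r : ℕ+, (per r : ℕ) = 1 + ⌈c * ((r : ℕ) : ℝ)⌉₊) →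
        SamePowerLaw (fun T => expectedTypes μ K T) (fun T => (T : ℝ) ^ (c / (c + 1))) ∧
        (∀ T : ℕ, shannonEntropy μ (block (santaFe K Z) T) ≠ ∞) ∧
        Tendsto (fun T : ℕ => (shannonEntropy μ (block (santaFe K Z) T)).toReal / T)
          atTop (𝓝 0) ∧
        SamePowerLaw
          (fun T => (shannonEntropy μ (block (santaFe K Z) T)).toReal / T)
          (fun T => 1 / (T : ℝ) ^ (1 - c / (c + 1)))) := by
  have hcoe : ∀ T, (0 : ℝ) < exp 1 * expectedTypes μ K T + 2 := fun T => by
    have := expectedTypes_nonneg μ K T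
    positivity
  have hne0 : ∀ q : ℝ, 0 < q → ∀ t, expectedPow μ (K t) (1 / q) ≠ 0 := fun q hq t =>
    (one_pos.trans_le (hK.one_le_expectedPow t (by positivity))).ne'
  refine ⟨fun q hq T hT t => ?_, fun Z hZ hind => ⟨fun T hT => ?_, fun q hq T hT t => ?_,
    fun c hc hper => ?_⟩⟩
  · by_cases h : expectedPow μ (K t) (1 / q) = ∞
    · rw [h, ENNReal.log_top, EReal.coe_mul_top_of_pos hq, EReal.coe_add_top,
        EReal.coe_mul_top_of_pos (hcoe T)]
      exact le_top
    · rw [ENNReal.log_eq_coe_log_toReal (hne0 q hq t) h]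
      exact_mod_cast coe_ennreal_le_of_le_ofReal (hK.bound_nonneg hq h hT)
        (hK.shannonEntropy_le hq h hT)
  · rw [hK.shannonEntropy_santaFe hZ hind]
    have h0 : 0 ≤ expectedTypes μ K T * log 2 :=
      mul_nonneg (expectedTypes_nonneg μ K T) (log_nonneg one_le_two)
    have h1 : ((expectedTypes μ K T * log 2 : ℝ) : EReal) =
        ((ENNReal.ofReal (expectedTypes μ K T * log 2) : ℝ≥0∞) : EReal) := by
      rw [EReal.coe_ennreal_ofReal, max_eq_left h0]
    rw [h1, EReal.coe_ennreal_le_coe_ennreal_iff]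
    exact le_add_self
  · by_cases h : expectedPow μ (K t) (1 / q) = ∞
    · rw [h, ENNReal.log_top, EReal.coe_mul_top_of_pos hq, EReal.coe_add_top, EReal.top_add_coe,
        EReal.coe_mul_top_of_pos (hcoe T)]
      exact le_top
    · rw [ENNReal.log_eq_coe_log_toReal (hne0 q hq t) h, hK.shannonEntropy_santaFe hZ hind]
      have h0 : 0 ≤ expectedTypes μ K T * log 2 :=
        mul_nonneg (expectedTypes_nonneg μ K T) (log_nonneg one_le_two)
      have h1 := hK.bound_nonneg hq h hT
      have h2 : (exp 1 * expectedTypes μ K T + 2) *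
          ((q + 2) * log T + q * log (expectedPow μ (K t) (1 / q)).toReal) +
            expectedTypes μ K T * log 2 ≤ (exp 1 * expectedTypes μ K T + 2) *
          ((q + 2) * log T + q * log (expectedPow μ (K t) (1 / q)).toReal + log 2 / exp 1) := by
        rw [mul_add _ _ (log 2 / exp 1), add_mul _ _ (log 2 / exp 1)]
        -- The summand `log 2 / e` is exactly what pays for one bit per type.
        have h3 : exp 1 * expectedTypes μ K T * (log 2 / exp 1) = expectedTypes μ K T * log 2 := by
          field_simp
        have h4 : 0 ≤ 2 * (log 2 / exp 1) := by positivity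
        linarith
      have h5 := coe_ennreal_le_of_le_ofReal ((add_nonneg h1 h0).trans h2)
        ((add_le_add_left (hK.shannonEntropy_le hq h hT) _).trans
          ((ENNReal.ofReal_add h1 h0).ge.trans (ENNReal.ofReal_le_ofReal h2)))
      exact_mod_cast h5
  · set b := c / (c + 1) with hb
    have hb0 : 0 < b := by positivity
    have hb1 : b < 1 := by rw [hb, div_lt_one (by positivity)]; linarith
    set D : ℝ := (exp (-(1 / c)) / (c + 3)) ^ b with hD
    have hD0 : 0 < D := by positivity
    set C : ℝ := 1 + (1 + 2 / c) ^ (1 / c) with hC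
    have hC0 : 0 < C := by positivity
    have hpow : Tendsto (fun T : ℕ => (T : ℝ) ^ b) atTop atTop :=
      (tendsto_rpow_atTop hb0).comp tendsto_natCast_atTop_atTop
    have hlog : Tendsto (fun T : ℕ => log (T : ℝ)) atTop atTop :=
      tendsto_log_atTop.comp tendsto_natCast_atTop_atTop
    -- Halving `D` absorbs the `-1` lost to the floor.
    have hElow : ∀ᶠ T : ℕ in atTop, D / 2 * (T : ℝ) ^ b ≤ expectedTypes μ K T := by
      filter_upwards [hpow.eventually_ge_atTop (2 / D), eventually_ge_atTop 1] with T h1 hT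
      have h2 := hK.rpow_le_expectedTypes hc hper hT
      have h3 : 2 ≤ D * (T : ℝ) ^ b := by
        rw [div_le_iff₀ hD0] at h1
        linarith
      linarith
    have hEupp : ∀ᶠ T : ℕ in atTop, expectedTypes μ K T ≤ C * (T : ℝ) ^ b * log T := by
      filter_upwards [hlog.eventually_ge_atTop 1, eventually_ge_atTop 1] with T h1 hT
      exact (hK.expectedTypes_le_rpow hc hper hT).trans
        (le_mul_of_one_le_right (by positivity) h1)
    have hq : 0 < 2 * c := by positivity
    have hfin := hK.expectedPow_ne_top hc hper 1
    set M := log (expectedPow μ (K 1) (1 / (2 * c))).toReal with hM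
    have hbound : ∀ T : ℕ, 1 ≤ T → shannonEntropy μ (block (santaFe K Z) T) ≤ ENNReal.ofReal
        ((exp 1 * expectedTypes μ K T + 2) * ((2 * c + 2) * log T + 2 * c * M) +
          expectedTypes μ K T * log 2) := by
      intro T hT
      rw [hK.shannonEntropy_santaFe hZ hind, ENNReal.ofReal_add (hK.bound_nonneg hq hfin hT)
        (mul_nonneg (expectedTypes_nonneg μ K T) (log_nonneg one_le_two))]
      exact add_le_add_left (hK.shannonEntropy_le hq hfin hT) _
    have hHfin : ∀ T : ℕ, shannonEntropy μ (block (santaFe K Z) T) ≠ ∞ := by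
      intro T
      rcases Nat.eq_zero_or_pos T with rfl | hT
      · exact shannonEntropy_block_zero_ne_top μ _
      · exact ne_top_of_le_ne_top ENNReal.ofReal_ne_top (hbound T hT)
    have hHlow : ∀ᶠ T : ℕ in atTop, D / 2 * log 2 * (T : ℝ) ^ b ≤
        (shannonEntropy μ (block (santaFe K Z) T)).toReal := by
      filter_upwards [hElow] with T h1
      have h2 : expectedTypes μ K T * log 2 ≤
          (shannonEntropy μ (block (santaFe K Z) T)).toReal := by
        rw [← ENNReal.ofReal_le_iff_le_toReal (hHfin T), hK.shannonEntropy_santaFe hZ hind]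
        exact le_add_self
      have h3 := mul_le_mul_of_nonneg_right h1 (log_nonneg one_le_two)
      linarith
    have hM0 : 0 ≤ M := by
      refine log_nonneg ?_
      rw [← ENNReal.toReal_one]
      exact ENNReal.toReal_mono hfin (hK.one_le_expectedPow 1 (one_div_pos.2 hq))
    -- Obtained from the entropy bound with `q = 2 c` by inserting `E ≤ C T ^ b`, `1 ≤ T ^ b` and `1
    -- ≤ log T`.
    set B : ℝ := (exp 1 * C + 2) * (2 * c + 2 + 2 * c * M) + C * log 2 with hB
    have hB0 : 0 < B := by positivity
    have hHupp : ∀ᶠ T : ℕ in atTop, (shannonEntropy μ (block (santaFe K Z) T)).toReal ≤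
        B * (T : ℝ) ^ b * log T := by
      filter_upwards [hlog.eventually_ge_atTop 1, eventually_ge_atTop 1] with T h1 hT
      have hE := hK.expectedTypes_le_rpow hc hper hT
      have hE0 := expectedTypes_nonneg μ K T
      have hTb : 1 ≤ (T : ℝ) ^ b := one_le_rpow (by exact_mod_cast hT) hb0.le
      have h2 : (shannonEntropy μ (block (santaFe K Z) T)).toReal ≤
          (exp 1 * expectedTypes μ K T + 2) * ((2 * c + 2) * log T + 2 * c * M) +
            expectedTypes μ K T * log 2 :=
        ENNReal.toReal_le_of_le_ofReal (by positivity) (hbound T hT)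
      calc _ ≤ _ := h2
        _ ≤ (exp 1 * (C * (T : ℝ) ^ b) + 2 * (T : ℝ) ^ b) *
              ((2 * c + 2) * log T + 2 * c * M * log T) + C * (T : ℝ) ^ b * (log 2 * log T) := by
            have h3 : 2 * c * M ≤ 2 * c * M * log T :=
              le_mul_of_one_le_right (by positivity) h1
            have h4 : log 2 ≤ log 2 * log T :=
              le_mul_of_one_le_right (log_nonneg one_le_two) h1
            have h5 : 2 ≤ 2 * (T : ℝ) ^ b := by linarith
            gcongr
        _ = _ := by rw [hB]; ring
    have hHlim := tendsto_log_div_log_of_le (by positivity : 0 < D / 2 * log 2) hB0 hHlow hHupp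
    have hHpos : ∀ᶠ T : ℕ in atTop, 0 < (shannonEntropy μ (block (santaFe K Z) T)).toReal := by
      filter_upwards [hHlow, eventually_gt_atTop 0] with T h1 hT
      have hT0 : (0 : ℝ) < T := by exact_mod_cast hT
      exact lt_of_lt_of_le (by positivity) h1
    have hrate := tendsto_log_div_rpow hHpos hHlim
    refine ⟨samePowerLaw_rpow hb0.ne' (tendsto_log_div_log_of_le (half_pos hD0) hC0 hElow hEupp),
      hHfin, ?_, ?_⟩
    · have h1 := tendsto_exp_atBot.comp (hrate.neg_mul_atTop (by linarith) hlog)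
      refine h1.congr' ?_
      filter_upwards [hHpos, eventually_gt_atTop 1] with T h2 hT
      have hT1 : (1 : ℝ) < T := by exact_mod_cast hT
      rw [Function.comp_apply, div_mul_cancel₀ _ (log_pos hT1).ne', exp_log]
      exact div_pos h2 (by linarith)
    · have h1 := samePowerLaw_rpow (by linarith : b - 1 ≠ 0) hrate
      refine h1.congr fun T => ?_
      simp only [one_div, ← rpow_neg (Nat.cast_nonneg T), neg_sub]
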